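/- Let $\alpha\in(\tfrac12,1)$, $\lambda>0$, $\sigma\in\mathbb{R}$, and let $\nu$ be a measure on $\mathbb{R}$ concentrated on $(0,\infty)$ with $\int x^2\,\nu(dx)<\infty$. For $\varepsilon>0$ and $t>0$ let $\kappa_\varepsilon(t)=\frac1\varepsilon t^{\alpha-1}E_{\alpha,\alpha}\!\left(-\frac{\lambda}{\varepsilon}t^\alpha\right)$, where $E_{a,b}(z)=\sum_{n\ge0}\frac{z^n}{\Gamma(an+b)}$ is the Mittag-Leffler function, and for $p\le0$ let $V_1(p)=\int_{[0,\infty)}(e^{px}-1-px)\,\nu(dx)$. Let $f:[0,\infty)\to(-\infty,0]$ be measurable and (essentially) bounded on $[0,T]$ for every $T>0$. Then: (i) for every $\varepsilon>0$ there is a unique continuous function $\psi_\varepsilon:[0,\infty)\to(-\infty,0]$ with $$\psi_\varepsilon(t)=\int_0^t\kappa_\varepsilon(t-s)\Big(f(s)+\tfrac12\sigma^2\psi_\varepsilon(s)^2+V_1(\psi_\varepsilon(s))\Big)\,ds,\qquad t\ge0;$$ (ii) there is a unique function $\psi_0:[0,\infty)\to(-\infty,0]$ with $$f(t)-\lambda\psi_0(t)+\tfrac12\sigma^2\psi_0(t)^2+V_1(\psi_0(t))=0,\qquad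 t\ge0;$$ (iii) for every $T>0$, $\psi_\varepsilon$ and $\psi_0$ belong to $L^1(0,T)$ and $\psi_\varepsilon\to\psi_0$ in $L^1(0,T)$ as $\varepsilon\downarrow0$. -/

import Mathlib

open MeasureTheory Set Filter
open scoped Topology ENNReal

namespace RoughHeston

/-- The two-parameter Mittag-Leffler function `E_{a,b}(z) = ∑ zⁿ / Γ(a n + b)` at a real argument
(the series converges for all `z` when `a > 0`). -/
noncomputable def mittagLeffler (a b z : ℝ) : ℝ :=
  ∑' n : ℕ, z ^ n / Real.Gamma (a * n + b)

/-- The kernel `κ_ε(t) = ε⁻¹ t^{α-1} E_{α,α}(-(lam/ε) t^α)`, for `t > 0`. -/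
noncomputable def kappa (α lam ε t : ℝ) : ℝ :=
  1 / ε * t ^ (α - 1) * mittagLeffler α α (-(lam / ε) * t ^ α)

/-- `V₁(p) = ∫_{[0,∞)} (e^{p x} - 1 - p x) ν(dx)`. -/
noncomputable def V1 (ν : Measure ℝ) (p : ℝ) : ℝ :=
  ∫ x in Ici (0 : ℝ), (Real.exp (p * x) - 1 - p * x) ∂ν

/-- `G(s, w) = f(s) + ½ σ² w² + V₁(w)`. -/
noncomputable def G (σ : ℝ) (ν : Measure ℝ) (f : ℝ → ℝ) (s w : ℝ) : ℝ :=
  f s + 1 / 2 * σ ^ 2 * w ^ 2 + V1 ν w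

/-- `ψ`, restricted to `[0,∞)`, is a continuous non-positive solution of the Riccati-Volterra
equation `ψ(t) = ∫₀ᵗ κ_ε(t - s) G(s, ψ(s)) ds`, `t ≥ 0`. -/
structure IsVolterraSolution (α lam σ : ℝ) (ν : Measure ℝ) (f : ℝ → ℝ) (ε : ℝ) (ψ : ℝ → ℝ) :
    Prop where
  continuousOn : ContinuousOn ψ (Ici 0)
  nonpos : ∀ t, 0 ≤ t → ψ t ≤ 0
  eq : ∀ t, 0 ≤ t → ψ t = ∫ s in (0 : ℝ)..t, kappa α lam ε (t - s) * G σ ν f s (ψ s)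

/-- `ψ₀`, restricted to `[0,∞)`, is a non-positive solution of the algebraic equation
`f(t) - lam ψ₀(t) + ½ σ² ψ₀(t)² + V₁(ψ₀(t)) = 0`, `t ≥ 0`. -/
structure IsAlgebraicSolution (lam σ : ℝ) (ν : Measure ℝ) (f : ℝ → ℝ) (ψ₀ : ℝ → ℝ) : Prop where
  nonpos : ∀ t, 0 ≤ t → ψ₀ t ≤ 0
  eq : ∀ t, 0 ≤ t → f t - lam * ψ₀ t + 1 / 2 * σ ^ 2 * ψ₀ t ^ 2 + V1 ν (ψ₀ t) = 0

end RoughHeston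

/-! Write N(w) = ½σ²w² + V₁(w). On (-∞, 0] the function N is nonnegative and decreasing, and on [-M,
0] it is Lipschitz with constant c = M(σ² + ∫x² dν) (`nonlin_sub_bounds`). The kernel `kappa α lam
ε` is nonnegative (by `mlKer_neg_pos`) and has mass at most 1/lam. Since lam ∫₀ᵗ κ = 1 -
E_{α,1}(-(lam/ε)t^α) tends to 1 as ε ↓ 0, lam κ is an approximate identity
(`tendsto_integral_abs_mul_vconv_kappa_sub`).

The constant c may exceed lam, so the equation as given need not be a contraction. The resolvent
identity `sub_mul_vconv_kappa` repairs this: with mu = lam + c and h(w) = N(w) + c w, the equation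
with kernel κ_lam and source f + N(ψ) is equivalent to the one with κ_mu and source f + h(ψ)
(`solvesOn_iff_shifted`). The slopes of N lie in [-c, 0], so those of h lie in [0, c], while κ_mu
has mass at most 1/mu. The contraction factor is c/(lam + c) < 1 whatever ε and T are. This yields
existence and uniqueness on each [0, T]; the bound -B/lam ≤ ψ, where |f| ≤ B, makes M independent of
ε as well.

The map w ↦ -lam w + N(w) has slopes at most -lam on (-∞, 0], whence the unique algebraic root. That
root satisfies mu ψ₀ = f + h(ψ₀), so ψ_ε - ψ₀ = (mu κ_mu * ψ₀ - ψ₀) + κ_mu * (h(ψ_ε) - h(ψ₀)). By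
Young's inequality the last term has L¹ norm at most (c/mu)‖ψ_ε - ψ₀‖ and is absorbed on the left
(`integral_abs_sub_le`); the first term tends to 0. -/

namespace RoughHeston

/-! ### Convergence and continuity of the Mittag-Leffler series -/

/-- Convexity of `log Γ` gives `Γ(y + a) ≥ (y - 1)^a Γ(y)`. -/
theorem rpow_mul_Gamma_le {y a : ℝ} (hy : 1 < y) (ha : 0 < a) :
    (y - 1) ^ a * Real.Gamma y ≤ Real.Gamma (y + a) := by
  -- Adjacent slopes over [y - 1, y] and [y, y + a]; the first equals log (y - 1) by the functional
  -- equation.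
  have h1 := Real.convexOn_log_Gamma.slope_mono_adjacent (x := y - 1) (y := y) (z := y + a)
    (by simp; linarith) (by simp; linarith) (by linarith) (by linarith)
  have hG : Real.Gamma y = (y - 1) * Real.Gamma (y - 1) := by
    have := Real.Gamma_add_one (s := y - 1) (by linarith)
    simpa using this
  have hp : 0 < Real.Gamma (y - 1) := Real.Gamma_pos_of_pos (by linarith)
  have hpy : 0 < Real.Gamma y := Real.Gamma_pos_of_pos (by linarith)
  have hpa : 0 < Real.Gamma (y + a) := Real.Gamma_pos_of_pos (by linarith)
  have hy1 : 0 < y - 1 := by linarith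
  simp only [Function.comp] at h1
  have h2 : Real.log (Real.Gamma y) - Real.log (Real.Gamma (y - 1)) = Real.log (y - 1) := by
    rw [hG, Real.log_mul hy1.ne' hp.ne']; ring
  rw [h2, sub_sub_cancel, div_one, add_sub_cancel_left, le_div_iff₀ ha] at h1
  rw [← Real.log_le_log_iff (by positivity) hpa,
    Real.log_mul (by positivity) hpy.ne', Real.log_rpow hy1]
  linarith

/-- By `rpow_mul_Gamma_le`, successive terms have ratio at most |x| (an + b - 1)^(-a), which tends
to 0. -/
theorem summable_pow_div_Gamma {a b : ℝ} (ha : 0 < a) (hb : 0 < b) (x : ℝ) :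
    Summable fun n : ℕ => x ^ n / Real.Gamma (a * n + b) := by
  rcases eq_or_ne x 0 with rfl | hx
  · refine summable_of_ne_finset_zero (s := {0}) fun n hn => ?_
    rw [zero_pow (by simpa using hn), zero_div]
  have hpos : ∀ n : ℕ, 0 < Real.Gamma (a * n + b) := fun n =>
    Real.Gamma_pos_of_pos (by positivity)
  have hlin : Tendsto (fun n : ℕ => a * (n : ℝ) + b - 1) atTop atTop := by
    have := (tendsto_natCast_atTop_atTop (R := ℝ)).const_mul_atTop ha
    simpa [add_sub_assoc] using tendsto_atTop_add_const_right atTop (b - 1) this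
  refine summable_of_ratio_test_tendsto_lt_one (l := 0) one_pos
    (Eventually.of_forall fun n => div_ne_zero (pow_ne_zero _ hx) (hpos n).ne') ?_
  have hlim : Tendsto (fun n : ℕ => |x| * (a * (n : ℝ) + b - 1) ^ (-a)) atTop (𝓝 0) := by
    simpa using ((tendsto_rpow_neg_atTop ha).comp hlin).const_mul |x|
  refine squeeze_zero' (Eventually.of_forall fun n => by positivity) ?_ hlim
  filter_upwards [hlin.eventually_gt_atTop 0] with n hn
  have h := rpow_mul_Gamma_le (y := a * n + b) (by linarith) ha
  have e : a * ((n + 1 : ℕ) : ℝ) + b = a * n + b + a := by push_cast; ring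
  rw [e, norm_div, norm_div, norm_pow, norm_pow, pow_succ, Real.norm_eq_abs,
    Real.norm_of_nonneg (hpos n).le,
    Real.norm_of_nonneg (Real.Gamma_pos_of_pos (by positivity)).le]
  have hG := hpos n
  have hG2 : 0 < Real.Gamma (a * n + b + a) := Real.Gamma_pos_of_pos (by positivity)
  have hx' : 0 < |x| := abs_pos.mpr hx
  rw [Real.rpow_neg hn.le, div_div_div_eq, div_le_iff₀ (by positivity)]
  have hr : 0 < (a * n + b - 1) ^ a := Real.rpow_pos_of_pos hn a
  have : 0 < |x| ^ n := by positivity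
  calc |x| ^ n * |x| * Real.Gamma (a * n + b)
      = |x| * ((a * n + b - 1) ^ a)⁻¹ * (((a * n + b - 1) ^ a * Real.Gamma (a * n + b)) * |x| ^ n) := by
        field_simp
    _ ≤ |x| * ((a * n + b - 1) ^ a)⁻¹ * (Real.Gamma (a * n + b + a) * |x| ^ n) := by
        gcongr

theorem continuous_mittagLeffler {a b : ℝ} (ha : 0 < a) (hb : 0 < b) :
    Continuous (mittagLeffler a b) := by
  rw [continuous_iff_continuousAt]
  intro z
  have hc : ContinuousOn (mittagLeffler a b) (Metric.ball 0 (|z| + 1)) := by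
    refine continuousOn_tsum (u := fun n : ℕ => (|z| + 1) ^ n / Real.Gamma (a * n + b))
      (fun n => by fun_prop) (summable_pow_div_Gamma ha hb _) fun n y hy => ?_
    have hG : 0 < Real.Gamma (a * n + b) := Real.Gamma_pos_of_pos (by positivity)
    rw [norm_div, norm_pow, Real.norm_of_nonneg hG.le]
    have : ‖y‖ ≤ |z| + 1 := by simpa using (mem_ball_zero_iff.mp hy).le
    gcongr
  exact hc.continuousAt (Metric.isOpen_ball.mem_nhds (by simp))

/-! ### Power and Mittag-Leffler kernels and their convolutions -/

/-- The one-sided convolution `(k * g)(t) = ∫₀ᵗ k(t - s) g(s) ds`. -/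
noncomputable def vconv (k g : ℝ → ℝ) (t : ℝ) : ℝ := ∫ s in (0 : ℝ)..t, k (t - s) * g s

/-- The fractional integration kernel `t^{a-1} / Γ(a)`. -/
noncomputable def powKer (a t : ℝ) : ℝ := t ^ (a - 1) / Real.Gamma a

/-- The kernel `t^{b-1} E_{a,b}(x t^a)`. -/
noncomputable def mlKer (a b x t : ℝ) : ℝ := t ^ (b - 1) * mittagLeffler a b (x * t ^ a)

theorem powKer_pos {a t : ℝ} (ha : 0 < a) (ht : 0 < t) : 0 < powKer a t :=
  div_pos (Real.rpow_pos_of_pos ht _) (Real.Gamma_pos_of_pos ha)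

/-- The density of the Beta distribution has total mass one. -/
theorem integral_beta {a b : ℝ} (ha : 0 < a) (hb : 0 < b) :
    IntervalIntegrable (fun s : ℝ => s ^ (a - 1) * (1 - s) ^ (b - 1)) volume 0 1 ∧
    ∫ s in (0 : ℝ)..1, s ^ (a - 1) * (1 - s) ^ (b - 1) =
      Real.Gamma a * Real.Gamma b / Real.Gamma (a + b) := by
  have hB : 0 < ProbabilityTheory.beta a b := ProbabilityTheory.beta_pos ha hb
  have h1 := ProbabilityTheory.lintegral_betaPDF_eq_one ha hb
  rw [ProbabilityTheory.lintegral_betaPDF] at h1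
  set F : ℝ → ℝ := fun x => 1 / ProbabilityTheory.beta a b * x ^ (a - 1) * (1 - x) ^ (b - 1)
    with hF
  have hm : AEStronglyMeasurable F (volume.restrict (Ioo 0 1)) :=
    (by fun_prop : Measurable F).aestronglyMeasurable
  have hpos : 0 ≤ᵐ[volume.restrict (Ioo 0 1)] F := by
    filter_upwards [ae_restrict_mem measurableSet_Ioo] with x hx
    have h0 : 0 ≤ x := hx.1.le
    have h1 : 0 ≤ 1 - x := by linarith [hx.2]
    simp only [hF, Pi.zero_apply]
    positivity
  have hint : Integrable F (volume.restrict (Ioo 0 1)) := by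
    rw [← lintegral_ofReal_ne_top_iff_integrable hm hpos, h1]; simp
  have hval : ∫ x in Ioo 0 1, F x = 1 := by
    rw [integral_eq_lintegral_of_nonneg_ae hpos hm, h1]; simp
  have e : (fun s : ℝ => s ^ (a - 1) * (1 - s) ^ (b - 1)) =
      fun s => ProbabilityTheory.beta a b * F s := by
    funext s; simp only [hF]; field_simp
  rw [e]
  constructor
  · rw [intervalIntegrable_iff_integrableOn_Ioo_of_le zero_le_one]
    exact hint.const_mul _
  · rw [intervalIntegral.integral_of_le zero_le_one, integral_Ioc_eq_integral_Ioo,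
      integral_const_mul, hval, mul_one, ProbabilityTheory.beta]

/-- Semigroup law of fractional integration: rescaling s by t reduces it to the Beta integral. -/
theorem integral_powKer {a b t : ℝ} (ha : 0 < a) (hb : 0 < b) (ht : 0 < t) :
    IntegrableOn (fun s => powKer a (t - s) * powKer b s) (Ioo 0 t) ∧
    ∫ s in Ioo 0 t, powKer a (t - s) * powKer b s = powKer (a + b) t := by
  obtain ⟨hi, hv⟩ := integral_beta hb ha
  have hGa := Real.Gamma_pos_of_pos ha
  have hGb := Real.Gamma_pos_of_pos hb
  have hGab : 0 < Real.Gamma (b + a) := Real.Gamma_pos_of_pos (by positivity)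
  have e : EqOn (fun s => powKer a (t - s) * powKer b s) (fun s => t ^ (a + b - 2) /
      (Real.Gamma a * Real.Gamma b) * ((s / t) ^ (b - 1) * (1 - s / t) ^ (a - 1))) (Ioo 0 t) := by
    intro s hs
    have h1 : 1 - s / t = (t - s) / t := by field_simp
    have h2 : 0 ≤ t - s := by linarith [hs.2]
    have h3 : t ^ (a + b - 2) = t ^ (a - 1) * t ^ (b - 1) := by
      rw [← Real.rpow_add ht]; ring_nf
    have h4 : 0 < t ^ (a - 1) := Real.rpow_pos_of_pos ht _
    have h5 : 0 < t ^ (b - 1) := Real.rpow_pos_of_pos ht _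
    simp only [powKer]
    rw [h1, Real.div_rpow hs.1.le ht.le, Real.div_rpow h2 ht.le, h3]
    field_simp
  have hi' : IntervalIntegrable (fun s : ℝ => (s / t) ^ (b - 1) * (1 - s / t) ^ (a - 1))
      volume 0 t := by
    have := hi.comp_mul_right (c := t⁻¹)
    simpa [div_eq_mul_inv] using this
  have hv' : ∫ s in (0 : ℝ)..t, (s / t) ^ (b - 1) * (1 - s / t) ^ (a - 1) =
      t * (Real.Gamma b * Real.Gamma a / Real.Gamma (b + a)) := by
    have := intervalIntegral.integral_comp_div (a := 0) (b := t)
      (fun s : ℝ => s ^ (b - 1) * (1 - s) ^ (a - 1)) ht.ne'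
    rw [this, zero_div, div_self ht.ne', hv, smul_eq_mul]
  rw [integrableOn_congr_fun e measurableSet_Ioo, setIntegral_congr_fun measurableSet_Ioo e]
  constructor
  · rw [intervalIntegrable_iff_integrableOn_Ioo_of_le ht.le] at hi'
    exact hi'.const_mul _
  · rw [integral_const_mul, ← integral_Ioc_eq_integral_Ioo,
      ← intervalIntegral.integral_of_le ht.le, hv', powKer, add_comm b a]
    rw [add_comm b a] at hGab
    have h3 : t ^ (a + b - 1) = t ^ (a + b - 2) * t := by
      rw [← Real.rpow_add_one ht.ne']; ring_nf
    rw [h3]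
    field_simp

theorem mul_powKer {a b x t : ℝ} (ht : 0 < t) (n : ℕ) :
    x ^ n * powKer (a * n + b) t =
      t ^ (b - 1) * ((x * t ^ a) ^ n / Real.Gamma (a * n + b)) := by
  have : t ^ (a * n + b - 1) = t ^ (b - 1) * (t ^ a) ^ n := by
    rw [← Real.rpow_natCast (t ^ a), ← Real.rpow_mul ht.le, ← Real.rpow_add ht]; ring_nf
  rw [powKer, this, mul_pow]; ring

theorem hasSum_mlKer {a b x t : ℝ} (ha : 0 < a) (hb : 0 < b) (ht : 0 < t) :
    HasSum (fun n : ℕ => x ^ n * powKer (a * n + b) t) (mlKer a b x t) := by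
  simp_rw [mul_powKer ht]
  exact (summable_pow_div_Gamma ha hb _).hasSum.mul_left _

theorem mlKer_zero {a b t : ℝ} (ha : 0 < a) (hb : 0 < b) (ht : 0 < t) :
    mlKer a b 0 t = powKer b t := by
  rw [← (hasSum_mlKer ha hb ht).tsum_eq, tsum_eq_single 0]
  · simp
  · intro n hn; simp [hn]

theorem mlKer_recursion {a b x t : ℝ} (ha : 0 < a) (hb : 0 < b) (ht : 0 < t) :
    mlKer a b x t = powKer b t + x * mlKer a (b + a) x t := by
  rw [← (hasSum_mlKer ha hb ht).tsum_eq, (hasSum_mlKer ha hb ht).summable.tsum_eq_zero_add,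
    ← (hasSum_mlKer ha (by positivity : 0 < b + a) ht).tsum_eq, ← tsum_mul_left]
  congr 1
  · simp
  · refine tsum_congr fun n => ?_
    rw [pow_succ']
    push_cast
    ring_nf

/-- With m = max |x| |y|, the terms (2m)^n `powKer (a * n + b) t` are bounded, and the spare factor
2^(-(i+j)) is summable over pairs. -/
theorem summable_mlKer_double {a b t : ℝ} (ha : 0 < a) (hb : 0 < b) (ht : 0 < t) (x y : ℝ) :
    Summable fun p : ℕ × ℕ => x ^ p.1 * y ^ p.2 * powKer (a * (p.1 + p.2 : ℕ) + b) t := by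
  set m := max |x| |y|
  have hs := (hasSum_mlKer (x := 2 * m) ha hb ht).summable
  obtain ⟨C, hC⟩ := hs.tendsto_atTop_zero.bddAbove_range
  have hg : Summable fun n : ℕ => (1 / 2 : ℝ) ^ n := summable_geometric_two
  have h2 := hg.mul_of_nonneg hg (fun n => by positivity) (fun n => by positivity)
  refine Summable.of_norm_bounded (h2.mul_left C) fun p => ?_
  have hp : 0 < powKer (a * (p.1 + p.2 : ℕ) + b) t := powKer_pos (by positivity) ht
  have hb := hC ⟨p.1 + p.2, rfl⟩
  simp only at hb
  have hm : 0 ≤ m := le_max_of_le_left (abs_nonneg _)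
  rw [norm_mul, norm_mul, norm_pow, norm_pow, Real.norm_of_nonneg hp.le, Real.norm_eq_abs,
    Real.norm_eq_abs]
  calc |x| ^ p.1 * |y| ^ p.2 * powKer (a * (p.1 + p.2 : ℕ) + b) t
      ≤ m ^ p.1 * m ^ p.2 * powKer (a * (p.1 + p.2 : ℕ) + b) t := by
        gcongr
        · exact le_max_left _ _
        · exact le_max_right _ _
    _ = ((2 * m) ^ (p.1 + p.2) * powKer (a * (p.1 + p.2 : ℕ) + b) t) *
        ((1 / 2) ^ p.1 * (1 / 2) ^ p.2) := by
        rw [mul_pow, pow_add, pow_add, one_div, inv_pow, inv_pow]; field_simp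
    _ ≤ C * ((1 / 2) ^ p.1 * (1 / 2) ^ p.2) := by gcongr

/-- Sum along antidiagonals and use (x - y) ∑_{i+j=n} xⁱ yʲ = x^(n+1) - y^(n+1). -/
theorem sub_mul_tsum_mlKer_double {a b t : ℝ} (ha : 0 < a) (hb : 0 < b) (ht : 0 < t) (x y : ℝ) :
    (x - y) * ∑' p : ℕ × ℕ, x ^ p.1 * y ^ p.2 * powKer (a * (p.1 + p.2 : ℕ) + b) t =
      x * mlKer a b x t - y * mlKer a b y t := by
  have hs := summable_mlKer_double ha hb ht x y
  have hs' := (Finset.HasAntidiagonal.sigmaAntidiagonalEquivProd (A := ℕ)).summable_iff.mpr hs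
  rw [← (Finset.HasAntidiagonal.sigmaAntidiagonalEquivProd (A := ℕ)).tsum_eq]
  simp only [Function.comp_def] at hs'
  rw [Summable.tsum_sigma' (fun n => (hasSum_fintype _).summable) hs', ← tsum_mul_left]
  rw [← (hasSum_mlKer ha hb ht).tsum_eq, ← (hasSum_mlKer ha hb ht).tsum_eq, ← tsum_mul_left,
    ← tsum_mul_left, ← Summable.tsum_sub]
  rotate_left
  · exact (hasSum_mlKer ha hb ht).summable.mul_left _
  · exact (hasSum_mlKer ha hb ht).summable.mul_left _
  refine tsum_congr fun n => ?_
  have h1 : ∑' c : Finset.HasAntidiagonal.antidiagonal n, (x ^ (c : ℕ × ℕ).1 * y ^ (c : ℕ × ℕ).2) =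
      ∑ i ∈ Finset.range (n + 1), x ^ i * y ^ (n - i) := by
    rw [tsum_fintype, ← Finset.Nat.sum_antidiagonal_eq_sum_range_succ (fun i j => x ^ i * y ^ j) n]
    exact Finset.sum_coe_sort _ (fun c : ℕ × ℕ => x ^ c.1 * y ^ c.2)
  have h2 : ∀ c : Finset.HasAntidiagonal.antidiagonal n,
      x ^ (Finset.HasAntidiagonal.sigmaAntidiagonalEquivProd ⟨n, c⟩ : ℕ × ℕ).1 *
        y ^ (Finset.HasAntidiagonal.sigmaAntidiagonalEquivProd ⟨n, c⟩ : ℕ × ℕ).2 *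
        powKer (a * ((Finset.HasAntidiagonal.sigmaAntidiagonalEquivProd ⟨n, c⟩ : ℕ × ℕ).1 +
          (Finset.HasAntidiagonal.sigmaAntidiagonalEquivProd ⟨n, c⟩ : ℕ × ℕ).2 : ℕ) + b) t =
      (x ^ (c : ℕ × ℕ).1 * y ^ (c : ℕ × ℕ).2) * powKer (a * n + b) t := by
    rintro ⟨c, hc⟩
    have := Finset.HasAntidiagonal.mem_antidiagonal.mp hc
    simp only [Finset.HasAntidiagonal.sigmaAntidiagonalEquivProd_apply, this]
  rw [tsum_congr h2, tsum_mul_right, h1, ← mul_assoc]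
  have h3 := (Commute.all x y).mul_geom_sum₂ (n + 1)
  rw [Nat.add_sub_cancel] at h3
  rw [h3]; ring

/-- Convolution of two Mittag-Leffler kernels. -/
theorem sub_mul_vconv_mlKer {a b c t : ℝ} (ha : 0 < a) (hb : 0 < b) (hc : 0 < c) (ht : 0 < t)
    (x y : ℝ) :
    (x - y) * vconv (mlKer a b x) (mlKer a c y) t =
      x * mlKer a (b + c) x t - y * mlKer a (b + c) y t := by
  rw [← sub_mul_tsum_mlKer_double ha (by positivity) ht, vconv,
    intervalIntegral.integral_of_le ht.le, integral_Ioc_eq_integral_Ioo]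
  congr 1
  -- Both series are multiplied out and integrated termwise by the semigroup law; the norms give the
  -- same double series at |x|, |y|, which justifies the exchange.
  set F : ℕ × ℕ → ℝ → ℝ := fun p s =>
    (x ^ p.1 * powKer (a * p.1 + b) (t - s)) * (y ^ p.2 * powKer (a * p.2 + c) s)
  have hF : ∀ p s, F p s = x ^ p.1 * y ^ p.2 *
      (powKer (a * p.1 + b) (t - s) * powKer (a * p.2 + c) s) := fun p s => by
    simp only [F]; ring
  have hidx : ∀ p : ℕ × ℕ, a * p.1 + b + (a * p.2 + c) = a * (p.1 + p.2 : ℕ) + (b + c) := by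
    intro p; push_cast; ring
  have hk : ∀ p : ℕ × ℕ, _ := fun p => integral_powKer (a := a * p.1 + b) (b := a * p.2 + c)
    (t := t) (by positivity) (by positivity) ht
  have hint : ∀ p, Integrable (F p) (volume.restrict (Ioo 0 t)) := fun p => by
    rw [funext (hF p)]; exact (hk p).1.const_mul _
  have hval : ∀ p : ℕ × ℕ, ∫ s in Ioo 0 t, F p s =
      x ^ p.1 * y ^ p.2 * powKer (a * (p.1 + p.2 : ℕ) + (b + c)) t := fun p => by
    simp_rw [hF]; rw [integral_const_mul, (hk p).2, hidx]
  have hnorm : ∀ p : ℕ × ℕ, ∫ s in Ioo 0 t, ‖F p s‖ =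
      |x| ^ p.1 * |y| ^ p.2 * powKer (a * (p.1 + p.2 : ℕ) + (b + c)) t := fun p => by
    rw [← hidx, ← (hk p).2, ← integral_const_mul]
    refine setIntegral_congr_fun measurableSet_Ioo fun s hs => ?_
    have h1 : 0 < powKer (a * p.1 + b) (t - s) := powKer_pos (by positivity) (by linarith [hs.2])
    have h2 : 0 < powKer (a * p.2 + c) s := powKer_pos (by positivity) hs.1
    simp only [hF]
    rw [norm_mul, norm_mul, norm_pow, norm_pow, Real.norm_of_nonneg (mul_pos h1 h2).le]
    rfl
  have hS := hasSum_integral_of_summable_integral_norm hint (by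
    simp_rw [hnorm]; exact summable_mlKer_double ha (by positivity) ht _ _)
  simp_rw [hval] at hS
  rw [hS.tsum_eq]
  refine setIntegral_congr_fun measurableSet_Ioo fun s hs => ?_
  have h1 := hasSum_mlKer (x := x) ha hb (sub_pos.mpr hs.2)
  have h2 := hasSum_mlKer (x := y) ha hc hs.1
  rw [← h1.tsum_eq, ← h2.tsum_eq]
  exact tsum_mul_tsum_of_summable_norm h1.summable.abs h2.summable.abs

theorem continuousOn_mlKer {a b x : ℝ} (ha : 0 < a) (hb : 0 < b) :
    ContinuousOn (mlKer a b x) (Ioi 0) := by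
  refine ContinuousOn.mul (fun t ht => ?_) ?_
  · exact (Real.continuousAt_rpow_const t (b - 1) (Or.inl (ne_of_gt ht))).continuousWithinAt
  · exact ((continuous_mittagLeffler ha hb).comp
      (continuous_const.mul (Real.continuous_rpow_const ha.le))).continuousOn

theorem intervalIntegrable_mlKer {a b x t : ℝ} (ha : 0 < a) (hb : 0 < b) :
    IntervalIntegrable (mlKer a b x) volume 0 t :=
  (intervalIntegral.intervalIntegrable_rpow' (by linarith)).mul_continuousOn
    ((continuous_mittagLeffler ha hb).comp
      (continuous_const.mul (Real.continuous_rpow_const ha.le))).continuousOn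

theorem continuousOn_powKer {a : ℝ} : ContinuousOn (powKer a) (Ioi 0) := fun t ht =>
  ((Real.continuousAt_rpow_const t (a - 1) (Or.inl (ne_of_gt ht))).div_const _).continuousWithinAt

theorem intervalIntegrable_powKer {a t : ℝ} (ha : 0 < a) :
    IntervalIntegrable (powKer a) volume 0 t :=
  (intervalIntegral.intervalIntegrable_rpow' (by linarith)).div_const _

theorem integral_powKer_self {a t : ℝ} (ha : 0 < a) :
    ∫ s in (0 : ℝ)..t, powKer a s = powKer (a + 1) t := by
  simp only [powKer]
  rw [intervalIntegral.integral_div, integral_rpow (Or.inl (by linarith)), sub_add_cancel,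
    add_sub_cancel_right, Real.zero_rpow ha.ne', Real.Gamma_add_one ha.ne', sub_zero, div_div]

/-- Two kernels with integrable singularity at `0` can be convolved. -/
theorem intervalIntegrable_comp_sub_mul {k g : ℝ → ℝ} {t : ℝ} (ht : 0 < t)
    (hk : ContinuousOn k (Ioi 0)) (hg : ContinuousOn g (Ioi 0))
    (hki : IntervalIntegrable k volume 0 t) (hgi : IntervalIntegrable g volume 0 t) :
    IntervalIntegrable (fun s => k (t - s) * g s) volume 0 t := by
  have hki' : IntervalIntegrable (fun s => k (t - s)) volume 0 t := by
    simpa using (hki.comp_sub_left t).symm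
  have h2 : 0 ≤ t / 2 := by linarith
  have h3 : t / 2 ≤ t := by linarith
  -- On either side of t/2 only one of the two factors can be singular.
  refine IntervalIntegrable.trans (b := t / 2) ?_ ?_
  · refine IntervalIntegrable.continuousOn_mul (hgi.mono_set ?_) (hk.comp (by fun_prop) ?_)
    · rw [uIcc_of_le h2, uIcc_of_le ht.le]; exact Icc_subset_Icc_right h3
    · intro s hs
      rw [uIcc_of_le h2] at hs
      simp only [mem_Ioi]; linarith [hs.2]
  · refine IntervalIntegrable.mul_continuousOn (hki'.mono_set ?_) (hg.mono ?_)
    · rw [uIcc_of_le h3, uIcc_of_le ht.le]; exact Icc_subset_Icc_left h2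
    · intro s hs
      rw [uIcc_of_le h3] at hs
      simp only [mem_Ioi]; linarith [hs.1]

/-- `powKer b` is the Mittag-Leffler kernel with parameter 0, so this is a special case of
`sub_mul_vconv_mlKer` divided by -x. -/
theorem vconv_powKer_mlKer {a b c x t : ℝ} (ha : 0 < a) (hb : 0 < b) (hc : 0 < c) (ht : 0 < t)
    (hx : x ≠ 0) : vconv (powKer b) (mlKer a c x) t = mlKer a (b + c) x t := by
  have h := sub_mul_vconv_mlKer ha hb hc ht 0 x
  have e : vconv (mlKer a b 0) (mlKer a c x) t = vconv (powKer b) (mlKer a c x) t := by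
    simp only [vconv, intervalIntegral.integral_of_le ht.le, integral_Ioc_eq_integral_Ioo]
    refine setIntegral_congr_fun measurableSet_Ioo fun s hs => ?_
    rw [mlKer_zero ha hb (sub_pos.mpr hs.2)]
  rw [e, zero_sub, zero_mul, zero_sub, neg_mul, neg_inj] at h
  exact mul_left_cancel₀ hx h

theorem vconv_powKer_one (g : ℝ → ℝ) (t : ℝ) :
    vconv (powKer 1) g t = ∫ s in (0 : ℝ)..t, g s := by
  simp [vconv, powKer]

/-! ### Positivity, mass and decay of the Mittag-Leffler kernels -/

/-- Since t ≤ r, (r/t)(t - s) ≤ r - s, and the exponent a - 1 is negative. This compares a Volterra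
equation at two different times in `mlKer_neg_pos`. -/
theorem powKer_div_le {a s t r : ℝ} (ha : 0 < a) (ha1 : a < 1) (hs : 0 < s) (hst : s < t)
    (htr : t ≤ r) : powKer a (r - s) ≤ powKer a r / powKer a t * powKer a (t - s) := by
  have hG := Real.Gamma_pos_of_pos ha
  have ht : 0 < t := by linarith
  have hr : 0 < r := by linarith
  have hts : 0 < t - s := by linarith
  have hrs : 0 < r - s := by linarith
  have key : (r / t * (t - s)) ^ (a - 1) ≥ (r - s) ^ (a - 1) := by
    refine Real.rpow_le_rpow_of_nonpos (by positivity) ?_ (by linarith)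
    rw [div_mul_eq_mul_div, div_le_iff₀ ht]
    nlinarith
  rw [Real.mul_rpow (by positivity) hts.le, Real.div_rpow hr.le ht.le] at key
  have h1 : 0 < t ^ (a - 1) := Real.rpow_pos_of_pos ht _
  simp only [powKer]
  rw [div_div_div_cancel_right₀ hG.ne', ← mul_div_assoc]
  gcongr

/-- The kernel e solves e = K - Λ K * e with K = `powKer a`. At a first zero r, compare this
equation with the one at a maximum point q of e just before r: by `powKer_div_le`, the memory of [0,
q] leaves at least (K(r)/K(q)) e(q), and the short interval [q, r] is too small to cancel it, so
e(r) > 0. -/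
theorem mlKer_neg_pos {a Λ t : ℝ} (ha : 0 < a) (ha1 : a < 1) (hΛ : 0 < Λ) (ht : 0 < t) :
    0 < mlKer a a (-Λ) t := by
  -- e may blow up at 0; its regular factor E has the same sign, is continuous and is positive at 0,
  -- so a first zero exists.
  set E : ℝ → ℝ := fun t => mittagLeffler a a (-Λ * t ^ a) with hE
  set e := mlKer a a (-Λ) with he
  have hEc : Continuous E := (continuous_mittagLeffler ha ha).comp
    (continuous_const.mul (Real.continuous_rpow_const ha.le))
  have heE : ∀ s, 0 < s → (0 < e s ↔ 0 < E s) := fun s hs =>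
    mul_pos_iff_of_pos_left (Real.rpow_pos_of_pos hs _)
  have hE0 : 0 < E 0 := by
    have : E 0 = 1 / Real.Gamma a := by
      simp only [hE, mittagLeffler, Real.zero_rpow ha.ne', mul_zero]
      rw [tsum_eq_single 0]
      · simp
      · intro n hn; simp [hn]
    rw [this]
    exact one_div_pos.mpr (Real.Gamma_pos_of_pos ha)
  by_contra hneg
  have hZ : IsCompact (Icc 0 t ∩ {s | E s ≤ 0}) :=
    isCompact_Icc.inter_right (isClosed_le hEc continuous_const)
  obtain ⟨r, hr⟩ := hZ.exists_isLeast ⟨t, ⟨ht.le, le_rfl⟩, by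
    rw [heE t ht] at hneg; exact not_lt.mp hneg⟩
  have hr0 : 0 < r := by
    rcases hr.1.1.1.eq_or_lt with h | h
    · exact absurd hr.1.2 (by rw [← h]; exact not_le.mpr hE0)
    · exact h
  have her : e r ≤ 0 := by
    by_contra h
    exact absurd hr.1.2 (not_le.mpr ((heE r hr0).mp (not_le.mp h)))
  have hpos : ∀ s, 0 < s → s < r → 0 < e s := fun s hs hsr => by
    rw [heE s hs]
    by_contra h
    exact absurd (hr.2 ⟨⟨hs.le, hsr.le.trans hr.1.1.2⟩, not_lt.mp h⟩) (not_le.mpr hsr)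
  have hec : ContinuousOn e (Ioi 0) := continuousOn_mlKer ha ha
  have hei : ∀ u, IntervalIntegrable e volume 0 u := fun u => intervalIntegrable_mlKer ha ha
  have hKe : ∀ u, 0 < u → IntervalIntegrable (fun s => powKer a (u - s) * e s) volume 0 u :=
    fun u hu => intervalIntegrable_comp_sub_mul hu continuousOn_powKer hec
      (intervalIntegrable_powKer ha) (hei u)
  have heq : ∀ u, 0 < u → Λ * ∫ s in (0 : ℝ)..u, powKer a (u - s) * e s = powKer a u - e u := by
    intro u hu
    have h1 := vconv_powKer_mlKer (x := -Λ) ha ha ha hu (by linarith)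
    have h2 := mlKer_recursion (x := -Λ) ha ha hu
    rw [vconv] at h1
    rw [he, h1, h2]; ring
  -- The mass Λ ∫ K over a window of length δ must stay below 1/2, the lower bound for K(r)/K(q); δ
  -- < r/2 ensures r ≤ 2q.
  obtain ⟨δ, hδ0, hδr, hδ⟩ : ∃ δ, 0 < δ ∧ δ < r / 2 ∧ Λ * powKer (a + 1) δ < 1 / 2 := by
    have hc : Tendsto (fun δ => Λ * powKer (a + 1) δ) (𝓝[>] 0) (𝓝 0) := by
      have : Continuous fun δ : ℝ => Λ * powKer (a + 1) δ := by
        simp only [powKer]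
        exact continuous_const.mul ((Real.continuous_rpow_const (by linarith)).div_const _)
      have h := this.tendsto 0
      simp only [powKer, add_sub_cancel_right, Real.zero_rpow ha.ne', zero_div, mul_zero] at h
      simp only [powKer, add_sub_cancel_right]
      exact h.mono_left nhdsWithin_le_nhds
    have h1 := hc.eventually (gt_mem_nhds (by norm_num : (0 : ℝ) < 1 / 2))
    have h2 := Ioo_mem_nhdsGT (by linarith : (0 : ℝ) < r / 2)
    obtain ⟨δ, h, h'⟩ := (h1.and h2).exists
    exact ⟨δ, h'.1, h'.2, h⟩
  obtain ⟨q, hq, hmax⟩ := isCompact_Icc.exists_isMaxOn (s := Icc (r - δ) r)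
    ⟨r, by linarith, le_rfl⟩ (hec.mono fun s hs => by simp only [mem_Ioi]; linarith [hs.1])
  have hq0 : 0 < q := by linarith [hq.1]
  have heq_pos : 0 < e q :=
    (hpos (r - δ) (by linarith) (by linarith)).trans_le (hmax ⟨le_rfl, by linarith⟩)
  have hqr : q < r := by
    rcases hq.2.eq_or_lt with h | h
    · rw [h] at heq_pos; linarith
    · exact h
  have hsplit := intervalIntegral.integral_add_adjacent_intervals
    ((hKe r hr0).mono_set (c := 0) (d := q) (by
      rw [uIcc_of_le hq0.le, uIcc_of_le hr0.le]; exact Icc_subset_Icc_right hqr.le))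
    ((hKe r hr0).mono_set (c := q) (d := r) (by
      rw [uIcc_of_le hqr.le, uIcc_of_le hr0.le]; exact Icc_subset_Icc_left hq0.le))
  have hfirst : ∫ s in (0 : ℝ)..q, powKer a (r - s) * e s ≤
      powKer a r / powKer a q * ∫ s in (0 : ℝ)..q, powKer a (q - s) * e s := by
    rw [← intervalIntegral.integral_const_mul]
    refine intervalIntegral.integral_mono_on_of_le_Ioo hq0.le
      ((hKe r hr0).mono_set (by
        rw [uIcc_of_le hq0.le, uIcc_of_le hr0.le]; exact Icc_subset_Icc_right hqr.le))
      ((hKe q hq0).const_mul _) fun s hs => ?_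
    rw [← mul_assoc]
    exact mul_le_mul_of_nonneg_right (powKer_div_le ha ha1 hs.1 hs.2 hqr.le)
      (hpos s hs.1 (hs.2.trans hqr)).le
  have hsecond : ∫ s in q..r, powKer a (r - s) * e s ≤ powKer (a + 1) (r - q) * e q := by
    have hi : IntervalIntegrable (fun s => powKer a (r - s)) volume q r := by
      have := (intervalIntegrable_powKer (a := a) (t := r - q) ha).comp_sub_left r
      simpa using this.symm
    have h : ∫ s in q..r, powKer a (r - s) * e q = powKer (a + 1) (r - q) * e q := by
      rw [intervalIntegral.integral_mul_const,
        intervalIntegral.integral_comp_sub_left (fun s => powKer a s), sub_self,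
        integral_powKer_self ha]
    rw [← h]
    refine intervalIntegral.integral_mono_on_of_le_Ioo hqr.le
      ((hKe r hr0).mono_set (by
        rw [uIcc_of_le hqr.le, uIcc_of_le hr0.le]; exact Icc_subset_Icc_left hq0.le))
      (hi.mul_const _) fun s hs => ?_
    exact mul_le_mul_of_nonneg_left (hmax ⟨by linarith [hq.1, hs.1], hs.2.le⟩)
      (powKer_pos ha (by linarith [hs.2])).le
  have hKr := powKer_pos ha hr0
  have hKq := powKer_pos ha hq0
  have hratio : 1 / 2 ≤ powKer a r / powKer a q := by
    simp only [powKer]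
    rw [div_div_div_cancel_right₀ (Real.Gamma_pos_of_pos ha).ne', ← Real.div_rpow hr0.le hq0.le]
    calc (1 / 2 : ℝ) = 2 ^ (-1 : ℝ) := by rw [Real.rpow_neg_one]; norm_num
      _ ≤ 2 ^ (a - 1) := Real.rpow_le_rpow_of_exponent_le (by norm_num) (by linarith)
      _ ≤ (r / q) ^ (a - 1) := by
        refine Real.rpow_le_rpow_of_nonpos (by positivity) ?_ (by linarith)
        rw [div_le_iff₀ hq0]; linarith [hq.1]
  have hmono : powKer (a + 1) (r - q) ≤ powKer (a + 1) δ := by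
    have : 0 < Real.Gamma (a + 1) := Real.Gamma_pos_of_pos (by linarith)
    simp only [powKer, add_sub_cancel_right]
    have h0 : 0 ≤ r - q := by linarith
    have h1 : r - q ≤ δ := by linarith [hq.1]
    gcongr
  have hA := heq r hr0
  have hB := heq q hq0
  rw [← hsplit, mul_add] at hA
  have h1 : Λ * ∫ s in (0 : ℝ)..q, powKer a (r - s) * e s ≤
      powKer a r / powKer a q * (powKer a q - e q) := by
    rw [← hB]; nlinarith [mul_le_mul_of_nonneg_left hfirst hΛ.le]
  have h2 : powKer a r / powKer a q * (powKer a q - e q) =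
      powKer a r - powKer a r / powKer a q * e q := by field_simp
  have h3 := mul_le_mul_of_nonneg_left hsecond hΛ.le
  have h4 : powKer a r / powKer a q * e q ≤ Λ * (powKer (a + 1) (r - q) * e q) := by linarith
  have h5 : Λ * powKer (a + 1) (r - q) ≤ Λ * powKer (a + 1) δ :=
    mul_le_mul_of_nonneg_left hmono hΛ.le
  nlinarith

/-- The recursion at b = 1, where `powKer 1` is the constant 1 and convolving with it is
integration. -/
theorem one_sub_integral_mlKer {a Λ t : ℝ} (ha : 0 < a) (hΛ : 0 < Λ) (ht : 0 < t) :
    1 - Λ * ∫ s in (0 : ℝ)..t, mlKer a a (-Λ) s = mlKer a 1 (-Λ) t := by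
  rw [← vconv_powKer_one, vconv_powKer_mlKer ha one_pos ha ht (by linarith),
    mlKer_recursion ha one_pos ht]
  simp [powKer]; ring

/-- It is the convolution of the positive kernels `powKer (1 - a)` and `mlKer a a (-Λ)`. -/
theorem mlKer_one_nonneg {a Λ t : ℝ} (ha : 0 < a) (ha1 : a < 1) (hΛ : 0 < Λ) (ht : 0 < t) :
    0 ≤ mlKer a 1 (-Λ) t := by
  have h := vconv_powKer_mlKer (x := -Λ) ha (sub_pos.mpr ha1) ha ht (by linarith)
  rw [sub_add_cancel] at h
  rw [← h, vconv, intervalIntegral.integral_of_le ht.le, integral_Ioc_eq_integral_Ioo]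
  exact setIntegral_nonneg measurableSet_Ioo fun s hs =>
    (mul_pos (powKer_pos (sub_pos.mpr ha1) (sub_pos.mpr hs.2)) (mlKer_neg_pos ha ha1 hΛ hs.1)).le

theorem integral_mlKer_le {a Λ t : ℝ} (ha : 0 < a) (ha1 : a < 1) (hΛ : 0 < Λ) (ht : 0 < t) :
    Λ * ∫ s in (0 : ℝ)..t, mlKer a a (-Λ) s ≤ 1 := by
  linarith [one_sub_integral_mlKer ha hΛ ht, mlKer_one_nonneg ha ha1 hΛ ht]

theorem mlKer_one_antitone {a Λ s t : ℝ} (ha : 0 < a) (ha1 : a < 1) (hΛ : 0 < Λ) (hs : 0 < s)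
    (hst : s ≤ t) : mlKer a 1 (-Λ) t ≤ mlKer a 1 (-Λ) s := by
  rw [← one_sub_integral_mlKer ha hΛ hs, ← one_sub_integral_mlKer ha hΛ (hs.trans_le hst)]
  have : ∫ u in (0 : ℝ)..s, mlKer a a (-Λ) u ≤ ∫ u in (0 : ℝ)..t, mlKer a a (-Λ) u := by
    refine intervalIntegral.integral_mono_interval le_rfl hs.le hst ?_
      (intervalIntegrable_mlKer ha ha)
    filter_upwards [ae_restrict_mem measurableSet_Ioc] with u hu
    exact (mlKer_neg_pos ha ha1 hΛ hu.1).le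
  nlinarith

/-- Decay of `E_{a,1}(-Λ t^a)`. -/
theorem mlKer_one_mul_le {a Λ t : ℝ} (ha : 0 < a) (ha1 : a < 1) (hΛ : 0 < Λ) (ht : 0 < t) :
    mlKer a 1 (-Λ) t * (Λ * powKer (a + 1) t) ≤ 1 := by
  have hx : -Λ ≠ 0 := by linarith
  -- Both sides are `mlKer a (a + 1) (-Λ) t`. The right side is at most 1/Λ; the left dominates the
  -- value at t times the mass of `powKer a`, by monotonicity.
  have h1 : vconv (powKer a) (mlKer a 1 (-Λ)) t = ∫ s in (0 : ℝ)..t, mlKer a a (-Λ) s := by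
    rw [vconv_powKer_mlKer ha ha one_pos ht hx, ← vconv_powKer_one,
      vconv_powKer_mlKer ha one_pos ha ht hx, add_comm]
  have hi : IntervalIntegrable (fun s => powKer a (t - s)) volume 0 t := by
    have := (intervalIntegrable_powKer (a := a) (t := t) ha).comp_sub_left t
    simpa using this.symm
  have h2 : powKer (a + 1) t * mlKer a 1 (-Λ) t ≤ vconv (powKer a) (mlKer a 1 (-Λ)) t := by
    have h : ∫ s in (0 : ℝ)..t, powKer a (t - s) * mlKer a 1 (-Λ) t =
        powKer (a + 1) t * mlKer a 1 (-Λ) t := by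
      rw [intervalIntegral.integral_mul_const,
        intervalIntegral.integral_comp_sub_left (fun s => powKer a s), sub_self, sub_zero,
        integral_powKer_self ha]
    rw [← h, vconv]
    refine intervalIntegral.integral_mono_on_of_le_Ioo ht.le (hi.mul_const _)
      (intervalIntegrable_comp_sub_mul ht continuousOn_powKer (continuousOn_mlKer ha one_pos)
        (intervalIntegrable_powKer ha) (intervalIntegrable_mlKer ha one_pos)) fun s hs => ?_
    exact mul_le_mul_of_nonneg_left (mlKer_one_antitone ha ha1 hΛ hs.1 hs.2.le)
      (powKer_pos ha (by linarith [hs.2])).le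
  have h3 := integral_mlKer_le ha ha1 hΛ ht
  rw [← h1] at h3
  nlinarith [mul_le_mul_of_nonneg_left h2 hΛ.le]

/-- The resolvent identity. -/
theorem sub_mul_vconv_mlKer_self {a t : ℝ} (ha : 0 < a) (ht : 0 < t) (x y : ℝ) :
    (x - y) * vconv (mlKer a a x) (mlKer a a y) t = mlKer a a x t - mlKer a a y t := by
  rw [sub_mul_vconv_mlKer ha ha ha ht, mlKer_recursion (x := x) ha ha ht,
    mlKer_recursion (x := y) ha ha ht]
  ring

/-! ### One-sided convolution of integrable kernels with bounded functions -/

open scoped Convolution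

/-- `g` is measurable and essentially bounded by `B` on `[0, T]`. -/
structure EssBddOn (g : ℝ → ℝ) (T B : ℝ) : Prop where
  meas : AEStronglyMeasurable g (volume.restrict (Icc 0 T))
  nonneg : 0 ≤ B
  bound : ∀ᵐ s ∂volume.restrict (Icc 0 T), |g s| ≤ B

namespace EssBddOn

variable {g h : ℝ → ℝ} {T B C : ℝ}

theorem mono (hg : EssBddOn g T B) {t : ℝ} (ht : t ≤ T) : EssBddOn g t B where
  meas := hg.meas.mono_set (Icc_subset_Icc_right ht)
  nonneg := hg.nonneg
  bound := ae_restrict_of_ae_restrict_of_subset (Icc_subset_Icc_right ht) hg.bound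

theorem integrableOn (hg : EssBddOn g T B) : IntegrableOn g (Icc 0 T) :=
  Integrable.of_bound (hg.meas) B hg.bound

theorem add (hg : EssBddOn g T B) (hh : EssBddOn h T C) :
    EssBddOn (fun s => g s + h s) T (B + C) where
  meas := hg.meas.add hh.meas
  nonneg := add_nonneg hg.nonneg hh.nonneg
  bound := by
    filter_upwards [hg.bound, hh.bound] with s h1 h2
    exact (abs_add_le _ _).trans (add_le_add h1 h2)

theorem const_mul (hg : EssBddOn g T B) (c : ℝ) : EssBddOn (fun s => c * g s) T (|c| * B) where
  meas := hg.meas.const_mul c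
  nonneg := mul_nonneg (abs_nonneg c) hg.nonneg
  bound := by
    filter_upwards [hg.bound] with s h1
    rw [abs_mul]
    exact mul_le_mul_of_nonneg_left h1 (abs_nonneg c)

theorem sub (hg : EssBddOn g T B) (hh : EssBddOn h T C) :
    EssBddOn (fun s => g s - h s) T (B + C) where
  meas := hg.meas.sub hh.meas
  nonneg := add_nonneg hg.nonneg hh.nonneg
  bound := by
    filter_upwards [hg.bound, hh.bound] with s h1 h2
    exact (abs_sub _ _).trans (add_le_add h1 h2)

theorem abs (hg : EssBddOn g T B) : EssBddOn (fun s => |g s|) T B where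
  meas := hg.meas.norm
  nonneg := hg.nonneg
  bound := by simpa using hg.bound

theorem integrable_indicator (hg : EssBddOn g T B) : Integrable ((Icc 0 T).indicator g) :=
  (integrable_indicator_iff measurableSet_Icc).mpr hg.integrableOn

theorem indicator_bound (hg : EssBddOn g T B) : ∀ᵐ s, ‖(Icc 0 T).indicator g s‖ ≤ B := by
  have := (ae_restrict_iff' measurableSet_Icc).mp hg.bound
  filter_upwards [this] with s hs
  by_cases h : s ∈ Icc 0 T
  · rw [indicator_of_mem h]; exact hs h
  · rw [indicator_of_notMem h]; simpa using hg.nonneg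

end EssBddOn

theorem EssBddOn.const {T B : ℝ} (hB : 0 ≤ B) (c : ℝ) (hc : |c| ≤ B) :
    EssBddOn (fun _ => c) T B where
  meas := aestronglyMeasurable_const
  nonneg := hB
  bound := Eventually.of_forall fun _ => hc

theorem ContinuousOn.essBddOn {g : ℝ → ℝ} {T : ℝ} (hg : ContinuousOn g (Icc 0 T)) :
    ∃ B, EssBddOn g T B := by
  obtain ⟨B, hB⟩ := isCompact_Icc.exists_bound_of_continuousOn hg
  refine ⟨max B 0, hg.aestronglyMeasurable measurableSet_Icc, le_max_right _ _, ?_⟩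
  filter_upwards [ae_restrict_mem measurableSet_Icc] with s hs
  exact (hB s hs).trans (le_max_left _ _)

section Conv

variable {k l g : ℝ → ℝ} {T B t : ℝ}

theorem vconv_congr {k' g' : ℝ → ℝ} (ht : 0 ≤ t) (hk : EqOn k k' (Ioi 0))
    (hg : EqOn g g' (Ioo 0 t)) : vconv k g t = vconv k' g' t := by
  simp only [vconv, intervalIntegral.integral_of_le ht, integral_Ioc_eq_integral_Ioo]
  refine setIntegral_congr_fun measurableSet_Ioo fun s hs => ?_
  rw [hk (sub_pos.mpr hs.2), hg hs]

theorem indicator_Ioi_of_nonpos {s : ℝ} (hs : s ≤ 0) : (Ioi 0).indicator k s = 0 :=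
  indicator_of_notMem (not_lt.mpr hs) k

theorem convolution_eq_zero_of_nonpos (hk : ∀ s ≤ 0, k s = 0) (hg : ∀ s < 0, g s = 0)
    (ht : t ≤ 0) : (k ⋆[ContinuousLinearMap.mul ℝ ℝ, volume] g) t = 0 := by
  rw [convolution_def]
  refine integral_eq_zero_of_ae (Eventually.of_forall fun r => ?_)
  simp only [ContinuousLinearMap.mul_apply', Pi.zero_apply]
  rcases le_or_gt r 0 with hr | hr
  · rw [hk r hr, zero_mul]
  · rw [hg (t - r) (by linarith), mul_zero]

/-- Extension by zero turns `vconv` into convolution on the line, from which continuity, Young's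
inequality and associativity are transferred. -/
theorem convolution_indicator_eq_vconv (hg : ∀ s < 0, g s = 0) (ht : 0 ≤ t) :
    ((Ioi 0).indicator k ⋆[ContinuousLinearMap.mul ℝ ℝ, volume] g) t = vconv k g t := by
  have h : ∀ s, (Ioi 0).indicator k (t - s) * g s =
      (Ico 0 t).indicator (fun s => k (t - s) * g s) s := by
    intro s
    rcases lt_or_ge s 0 with h0 | h0
    · rw [hg s h0, mul_zero, indicator_of_notMem (fun h => not_le.mpr h0 h.1)]
    rcases lt_or_ge s t with h1 | h1
    · rw [indicator_of_mem (mem_Ioi.mpr (sub_pos.mpr h1)), indicator_of_mem (mem_Ico.mpr ⟨h0, h1⟩)]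
    · rw [indicator_Ioi_of_nonpos (by simpa using h1), zero_mul,
        indicator_of_notMem (fun h => not_lt.mpr h1 h.2)]
  rw [convolution_eq_swap]
  simp only [ContinuousLinearMap.mul_apply', h]
  rw [integral_indicator measurableSet_Ico, vconv, intervalIntegral.integral_of_le ht,
    integral_Ico_eq_integral_Ioo, integral_Ioc_eq_integral_Ioo]

theorem convolution_indicator_eq_vconv_indicator (ht : t ∈ Icc 0 T) :
    ((Ioi 0).indicator k ⋆[ContinuousLinearMap.mul ℝ ℝ, volume] (Icc 0 T).indicator g) t =
      vconv k g t := by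
  rw [convolution_indicator_eq_vconv (fun s hs => indicator_of_notMem
    (fun h => not_le.mpr hs h.1) _) ht.1]
  exact vconv_congr ht.1 (fun _ _ => rfl) fun s hs =>
    indicator_of_mem (mem_Icc.mpr ⟨hs.1.le, hs.2.le.trans ht.2⟩) _

theorem intervalIntegrable_comp_sub (hk : IntegrableOn k (Ioi 0)) (ht : 0 ≤ t) :
    IntervalIntegrable (fun s => k (t - s)) volume 0 t := by
  have h : IntervalIntegrable k volume 0 t := by
    rw [intervalIntegrable_iff_integrableOn_Ioc_of_le ht]
    exact hk.mono_set Ioc_subset_Ioi_self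
  simpa using (h.comp_sub_left t).symm

theorem intervalIntegrable_vconv (hk : IntegrableOn k (Ioi 0)) (hg : EssBddOn g t B)
    (ht : 0 ≤ t) : IntervalIntegrable (fun s => k (t - s) * g s) volume 0 t := by
  have h := intervalIntegrable_comp_sub hk ht
  rw [intervalIntegrable_iff_integrableOn_Icc_of_le ht] at h ⊢
  exact h.mul_bdd hg.meas hg.bound

theorem vconv_add {h : ℝ → ℝ} {C : ℝ} (hk : IntegrableOn k (Ioi 0)) (hg : EssBddOn g t B)
    (hh : EssBddOn h t C) (ht : 0 ≤ t) :
    vconv k (fun s => g s + h s) t = vconv k g t + vconv k h t := by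
  simp only [vconv, mul_add]
  exact intervalIntegral.integral_add (intervalIntegrable_vconv hk hg ht)
    (intervalIntegrable_vconv hk hh ht)

theorem vconv_sub {h : ℝ → ℝ} {C : ℝ} (hk : IntegrableOn k (Ioi 0)) (hg : EssBddOn g t B)
    (hh : EssBddOn h t C) (ht : 0 ≤ t) :
    vconv k (fun s => g s - h s) t = vconv k g t - vconv k h t := by
  simp only [vconv, mul_sub]
  exact intervalIntegral.integral_sub (intervalIntegrable_vconv hk hg ht)
    (intervalIntegrable_vconv hk hh ht)

theorem vconv_const_mul (c : ℝ) : vconv k (fun s => c * g s) t = c * vconv k g t := by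
  simp only [vconv, mul_left_comm _ c]
  exact intervalIntegral.integral_const_mul _ _

theorem vconv_const (c : ℝ) : vconv k (fun _ => c) t = (∫ s in (0 : ℝ)..t, k s) * c := by
  simp only [vconv]
  rw [intervalIntegral.integral_mul_const, intervalIntegral.integral_comp_sub_left (fun s => k s),
    sub_self, sub_zero]

theorem vconv_mono {h : ℝ → ℝ} {C : ℝ} (hk : IntegrableOn k (Ioi 0)) (hk0 : ∀ s, 0 < s → 0 ≤ k s)
    (hg : EssBddOn g t B) (hh : EssBddOn h t C) (ht : 0 ≤ t)
    (hgh : ∀ᵐ s ∂volume.restrict (Icc 0 t), g s ≤ h s) : vconv k g t ≤ vconv k h t := by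
  have h1 := intervalIntegrable_vconv hk hg ht
  have h2 := intervalIntegrable_vconv hk hh ht
  rw [intervalIntegrable_iff_integrableOn_Ioo_of_le ht] at h1 h2
  simp only [vconv, intervalIntegral.integral_of_le ht, integral_Ioc_eq_integral_Ioo]
  refine integral_mono_ae h1 h2 ?_
  filter_upwards [ae_restrict_of_ae_restrict_of_subset Ioo_subset_Icc_self hgh,
    ae_restrict_mem measurableSet_Ioo] with s hs hs'
  exact mul_le_mul_of_nonneg_left hs (hk0 _ (sub_pos.mpr hs'.2))

theorem abs_vconv_le_vconv_abs (hk : IntegrableOn k (Ioi 0)) (hk0 : ∀ s, 0 < s → 0 ≤ k s)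
    (hg : EssBddOn g t B) (ht : 0 ≤ t) : |vconv k g t| ≤ vconv k (fun s => |g s|) t := by
  rw [abs_le]
  constructor
  · have : vconv k (fun s => (-1) * |g s|) t ≤ vconv k g t :=
      vconv_mono hk hk0 (hg.abs.const_mul _) hg ht
        (Eventually.of_forall fun s => by linarith [neg_abs_le (g s)])
    rw [vconv_const_mul] at this
    linarith
  · exact vconv_mono hk hk0 hg hg.abs ht (Eventually.of_forall fun s => le_abs_self _)

theorem abs_vconv_le (hk : IntegrableOn k (Ioi 0)) (hk0 : ∀ s, 0 < s → 0 ≤ k s)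
    (hg : EssBddOn g t B) (ht : 0 ≤ t) : |vconv k g t| ≤ (∫ s in (0 : ℝ)..t, k s) * B := by
  rw [← vconv_const]
  exact (abs_vconv_le_vconv_abs hk hk0 hg ht).trans (vconv_mono hk hk0 hg.abs
    (EssBddOn.const hg.nonneg B (abs_of_nonneg hg.nonneg).le) ht hg.bound)

/-- Approximating k in L¹ by continuous compactly supported kernels approximates the convolution
uniformly, g being bounded. -/
theorem continuous_convolution_of_bdd {k g : ℝ → ℝ} {B : ℝ} (hk : Integrable k)
    (hg : Integrable g) (hB : ∀ᵐ s, ‖g s‖ ≤ B) :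
    Continuous (k ⋆[ContinuousLinearMap.mul ℝ ℝ, volume] g) := by
  refine continuous_of_uniform_approx_of_continuous fun u hu => ?_
  obtain ⟨ε, hε, hεu⟩ := Metric.mem_uniformity_dist.mp hu
  have hB' : 0 ≤ max B 0 := le_max_right _ _
  obtain ⟨φ, hφc, hφ, hφcont, hφi⟩ :=
    hk.exists_hasCompactSupport_integral_sub_le (ε := ε / (2 * (max B 0 + 1))) (by positivity)
  refine ⟨_, hφc.continuous_convolution_left (ContinuousLinearMap.mul ℝ ℝ) hφcont
    hg.locallyIntegrable, fun t => hεu ?_⟩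
  have hi : ∀ {f : ℝ → ℝ}, Integrable f → Integrable fun s => f (t - s) * g s := fun hf =>
    (hf.comp_sub_left t).mul_bdd hg.aestronglyMeasurable hB
  rw [convolution_eq_swap, convolution_eq_swap, dist_eq_norm]
  simp only [ContinuousLinearMap.mul_apply']
  rw [← integral_sub (hi hk) (hi hφi)]
  have hle : ‖∫ s, (k (t - s) * g s - φ (t - s) * g s)‖ ≤
      ∫ s, ‖k (t - s) - φ (t - s)‖ * max B 0 := by
    refine norm_integral_le_of_norm_le (((hk.sub hφi).norm.comp_sub_left t).mul_const _) ?_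
    filter_upwards [hB] with s hs
    rw [← sub_mul, norm_mul]
    exact mul_le_mul_of_nonneg_left (hs.trans (le_max_left _ _)) (norm_nonneg _)
  rw [integral_mul_const, integral_sub_left_eq_self (fun s => ‖k s - φ s‖)] at hle
  calc _ ≤ _ := hle
    _ ≤ ε / (2 * (max B 0 + 1)) * max B 0 := mul_le_mul_of_nonneg_right hφ hB'
    _ < ε := by
      rw [div_mul_eq_mul_div, div_lt_iff₀ (by positivity)]
      nlinarith

theorem continuousOn_vconv (hk : IntegrableOn k (Ioi 0)) (hg : EssBddOn g T B) :
    ContinuousOn (vconv k g) (Icc 0 T) :=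
  (continuous_convolution_of_bdd ((integrable_indicator_iff measurableSet_Ioi).mpr hk)
    hg.integrable_indicator hg.indicator_bound).continuousOn.congr fun _ ht =>
      (convolution_indicator_eq_vconv_indicator ht).symm

/-- Young's inequality in `L¹`. -/
theorem integral_abs_vconv_le (hk : IntegrableOn k (Ioi 0)) (hk0 : ∀ s, 0 < s → 0 ≤ k s)
    (hg : EssBddOn g T B) :
    ∫ t in Icc 0 T, |vconv k g t| ≤ (∫ s in Ioi 0, k s) * ∫ t in Icc 0 T, |g t| := by
  have hki := (integrable_indicator_iff measurableSet_Ioi).mpr hk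
  have hgi := hg.abs.integrable_indicator
  have hi := hki.integrable_convolution (ContinuousLinearMap.mul ℝ ℝ) hgi
  have hv := integral_convolution (ContinuousLinearMap.mul ℝ ℝ) hki hgi
  rw [integral_indicator measurableSet_Ioi, integral_indicator measurableSet_Icc,
    ContinuousLinearMap.mul_apply'] at hv
  rw [← hv]
  have hpos : ∀ t, 0 ≤ ((Ioi 0).indicator k ⋆[ContinuousLinearMap.mul ℝ ℝ, volume]
      (Icc 0 T).indicator fun s => |g s|) t := fun t => by
    refine integral_nonneg fun s => mul_nonneg ?_ ?_
    · exact indicator_nonneg (fun s hs => hk0 s hs) _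
    · exact indicator_nonneg (fun s _ => abs_nonneg _) _
  refine le_trans ?_ (setIntegral_le_integral (s := Icc 0 T) hi (Eventually.of_forall hpos))
  refine setIntegral_mono_on ?_ hi.integrableOn measurableSet_Icc fun t ht => ?_
  · exact (continuousOn_vconv hk hg).abs.integrableOn_Icc
  · rw [convolution_indicator_eq_vconv_indicator ht]
    exact abs_vconv_le_vconv_abs hk hk0 (hg.mono ht.2) ht.1

theorem vconv_assoc (hk : IntegrableOn k (Ioi 0)) (hl : IntegrableOn l (Ioi 0))
    (hg : EssBddOn g T B) (ht : t ∈ Icc 0 T) :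
    vconv (vconv k l) g t = vconv k (vconv l g) t := by
  have hki := (integrable_indicator_iff measurableSet_Ioi).mpr hk
  have hli := (integrable_indicator_iff measurableSet_Ioi).mpr hl
  have hgi := hg.integrable_indicator
  have hassoc := convolution_assoc (ContinuousLinearMap.mul ℝ ℝ) (ContinuousLinearMap.mul ℝ ℝ)
    (ContinuousLinearMap.mul ℝ ℝ) (ContinuousLinearMap.mul ℝ ℝ) (μ := volume) (ν := volume)
    (fun x y z => by simp [mul_assoc]) (x₀ := t) hki.aestronglyMeasurable
    hli.aestronglyMeasurable hgi.aestronglyMeasurable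
    (hki.ae_convolution_exists _ hli) (hli.norm.ae_convolution_exists _ hgi.norm) (by
      -- Associativity at the given point t, not just almost everywhere, needs integrability there:
      -- boundedness of g makes |l| * |g| bounded.
      have hc := hli.norm.integrable_convolution (ContinuousLinearMap.mul ℝ ℝ) hgi.norm
      refine Integrable.mul_bdd (c := (∫ s, ‖(Ioi 0).indicator l s‖) * B) hki.norm
        (hc.comp_sub_left t).aestronglyMeasurable (Eventually.of_forall fun s => ?_)
      rw [convolution_eq_swap, ← integral_mul_const,
        ← integral_sub_left_eq_self (fun r => ‖(Ioi 0).indicator l r‖ * B) volume (t - s)]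
      refine norm_integral_le_of_norm_le ((hli.norm.comp_sub_left (t - s)).mul_const _) ?_
      filter_upwards [hg.indicator_bound] with r hr
      rw [ContinuousLinearMap.mul_apply', norm_mul, norm_norm, norm_norm]
      exact mul_le_mul_of_nonneg_left hr (norm_nonneg _))
  have h1 : ((Ioi 0).indicator k ⋆[ContinuousLinearMap.mul ℝ ℝ, volume] (Ioi 0).indicator l) =
      (Ioi 0).indicator (vconv k l) := by
    funext s
    rcases le_or_gt s 0 with h0 | h0
    · rw [indicator_Ioi_of_nonpos h0, convolution_eq_zero_of_nonpos
        (fun r => indicator_Ioi_of_nonpos) (fun r hr => indicator_Ioi_of_nonpos hr.le) h0]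
    · rw [indicator_of_mem (mem_Ioi.mpr h0), convolution_indicator_eq_vconv
        (fun r hr => indicator_Ioi_of_nonpos hr.le) h0.le]
      exact vconv_congr h0.le (fun _ _ => rfl) fun r hr => indicator_of_mem (mem_Ioi.mpr hr.1) _
  rw [h1, convolution_indicator_eq_vconv_indicator ht, convolution_indicator_eq_vconv ?_ ht.1]
    at hassoc
  · rw [hassoc]
    exact vconv_congr ht.1 (fun _ _ => rfl) fun r hr =>
      convolution_indicator_eq_vconv_indicator ⟨hr.1.le, hr.2.le.trans ht.2⟩
  · exact fun s hs => convolution_eq_zero_of_nonpos (fun r => indicator_Ioi_of_nonpos)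
      (fun r hr => indicator_of_notMem (fun h => not_le.mpr hr h.1) _) hs.le

end Conv

/-! ### The kernels κ as an approximate identity -/

section Kernel

variable {α lam ε : ℝ}

theorem kappa_eq_mlKer (t : ℝ) :
    kappa α lam ε t = 1 / ε * mlKer α α (-(lam / ε)) t := by
  rw [kappa, mlKer, mul_assoc]

theorem kappa_nonneg (hα : α ∈ Ioo 0 1) (hlam : 0 < lam) (hε : 0 < ε) {t : ℝ} (ht : 0 < t) :
    0 ≤ kappa α lam ε t := by
  rw [kappa_eq_mlKer]
  have := mlKer_neg_pos hα.1 hα.2 (div_pos hlam hε) ht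
  positivity

theorem mul_integral_kappa (hε : 0 < ε) (t : ℝ) :
    lam * ∫ s in (0 : ℝ)..t, kappa α lam ε s =
      lam / ε * ∫ s in (0 : ℝ)..t, mlKer α α (-(lam / ε)) s := by
  simp only [kappa_eq_mlKer]
  rw [intervalIntegral.integral_const_mul]
  field_simp

theorem mul_integral_kappa_le (hα : α ∈ Ioo 0 1) (hlam : 0 < lam) (hε : 0 < ε) {t : ℝ}
    (ht : 0 ≤ t) : lam * ∫ s in (0 : ℝ)..t, kappa α lam ε s ≤ 1 := by
  rcases ht.eq_or_lt with rfl | ht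
  · simp
  · rw [mul_integral_kappa hε]
    exact integral_mlKer_le hα.1 hα.2 (div_pos hlam hε) ht

/-- The missing mass is E_{α,1}(-(lam/ε)t^α), and `mlKer_one_mul_le` makes it O(ε) for fixed t. -/
theorem one_sub_mul_integral_kappa_le (hα : α ∈ Ioo 0 1) (hlam : 0 < lam) (hε : 0 < ε) {t : ℝ}
    (ht : 0 < t) :
    1 - lam * ∫ s in (0 : ℝ)..t, kappa α lam ε s ≤ ε / (lam * powKer (α + 1) t) := by
  have hΛ := div_pos hlam hε
  have hK : 0 < powKer (α + 1) t := powKer_pos (by linarith [hα.1]) ht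
  rw [mul_integral_kappa hε, one_sub_integral_mlKer hα.1 hΛ ht, le_div_iff₀ (by positivity)]
  have := mlKer_one_mul_le hα.1 hα.2 hΛ ht
  have h2 := mul_le_mul_of_nonneg_right this hε.le
  calc _ = mlKer α 1 (-(lam / ε)) t * (lam / ε * powKer (α + 1) t) * ε := by field_simp
    _ ≤ _ := by linarith

theorem integrableOn_kappa (hα : α ∈ Ioo 0 1) (hlam : 0 < lam) (hε : 0 < ε) :
    IntegrableOn (kappa α lam ε) (Ioi 0) := by
  have hi : ∀ t, 0 ≤ t → IntervalIntegrable (kappa α lam ε) volume 0 t := fun t _ => by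
    rw [funext kappa_eq_mlKer]
    exact (intervalIntegrable_mlKer hα.1 hα.1).const_mul _
  refine integrableOn_Ioi_of_intervalIntegral_norm_bounded (1 / lam) 0 (b := fun n : ℕ => (n : ℝ))
    (fun n => ?_) tendsto_natCast_atTop_atTop (Eventually.of_forall fun n => ?_)
  · rw [← intervalIntegrable_iff_integrableOn_Ioc_of_le n.cast_nonneg]
    exact hi n n.cast_nonneg
  · rw [intervalIntegral.integral_congr_ae (g := kappa α lam ε), le_div_iff₀ hlam, mul_comm]
    · exact mul_integral_kappa_le hα hlam hε n.cast_nonneg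
    · refine Eventually.of_forall fun s hs => ?_
      rw [uIoc_of_le n.cast_nonneg] at hs
      exact Real.norm_of_nonneg (kappa_nonneg hα hlam hε hs.1)

theorem mul_integral_Ioi_kappa_le (hα : α ∈ Ioo 0 1) (hlam : 0 < lam) (hε : 0 < ε) :
    lam * ∫ s in Ioi 0, kappa α lam ε s ≤ 1 :=
  le_of_tendsto ((intervalIntegral_tendsto_integral_Ioi 0 (integrableOn_kappa hα hlam hε)
    (tendsto_natCast_atTop_atTop (R := ℝ))).const_mul lam)
    (Eventually.of_forall fun n => mul_integral_kappa_le hα hlam hε n.cast_nonneg)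

/-- The resolvent identity for the kernels `κ`. -/
theorem sub_mul_vconv_kappa (hα : α ∈ Ioo 0 1) (lam mu : ℝ) (hε : 0 < ε) {t : ℝ} (ht : 0 < t) :
    (mu - lam) * vconv (kappa α lam ε) (kappa α mu ε) t = kappa α lam ε t - kappa α mu ε t := by
  have h := sub_mul_vconv_mlKer_self hα.1 ht (-(lam / ε)) (-(mu / ε))
  have e : vconv (kappa α lam ε) (kappa α mu ε) t = 1 / ε * (1 / ε *
      vconv (mlKer α α (-(lam / ε))) (mlKer α α (-(mu / ε))) t) := by
    simp only [vconv]
    rw [← intervalIntegral.integral_const_mul, ← intervalIntegral.integral_const_mul]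
    refine intervalIntegral.integral_congr fun s _ => ?_
    simp only [kappa_eq_mlKer]
    ring
  rw [e, kappa_eq_mlKer, kappa_eq_mlKer, ← mul_sub, ← h]
  field_simp
  ring

theorem abs_mul_vconv_kappa_sub_le (hα : α ∈ Ioo 0 1) (hlam : 0 < lam) (hε : 0 < ε) {φ : ℝ → ℝ}
    {t δ η B : ℝ} (hδ : 0 < δ) (hδt : δ ≤ t) (hη : 0 ≤ η) (hφ : EssBddOn φ t B) (hφt : |φ t| ≤ B)
    (hφδ : ∀ s, t - δ < s → s ≤ t → |φ s - φ t| ≤ η) :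
    |lam * vconv (kappa α lam ε) φ t - φ t| ≤ η + 3 * B * (ε / (lam * powKer (α + 1) δ)) := by
  have ht : 0 < t := hδ.trans_le hδt
  have hk := integrableOn_kappa hα hlam hε
  have hk0 : ∀ s, 0 < s → 0 ≤ kappa α lam ε s := fun s => kappa_nonneg hα hlam hε
  have hB := hφ.nonneg
  have hc : EssBddOn (fun _ => φ t) t B := EssBddOn.const hB _ hφt
  have hdiff := hφ.sub hc
  -- |φ s - φ t| is at most η within δ of t and at most 2B elsewhere, almost everywhere.
  set χ : ℝ → ℝ := {s | s ≤ t - δ}.indicator fun _ => 1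
  have hχ : EssBddOn χ t 1 := by
    refine ⟨aestronglyMeasurable_const.indicator measurableSet_Iic, zero_le_one,
      Eventually.of_forall fun s => ?_⟩
    by_cases h : s ∈ {s | s ≤ t - δ}
    · simp [χ, indicator_of_mem h]
    · simp [χ, indicator_of_notMem h]
  have hmaj : EssBddOn (fun s => η + 2 * B * χ s) t (η + |2 * B| * 1) :=
    (EssBddOn.const hη η (abs_of_nonneg hη).le).add (hχ.const_mul _)
  have h1 : |vconv (kappa α lam ε) (fun s => φ s - φ t) t| ≤
      vconv (kappa α lam ε) (fun s => η + 2 * B * χ s) t := by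
    refine (abs_vconv_le_vconv_abs hk hk0 hdiff ht.le).trans
      (vconv_mono hk hk0 hdiff.abs hmaj ht.le ?_)
    filter_upwards [hφ.bound, ae_restrict_mem measurableSet_Icc] with s hs hst
    rcases le_or_gt s (t - δ) with h | h
    · rw [show χ s = 1 from indicator_of_mem (s := {s | s ≤ t - δ}) h _]
      have := abs_sub (φ s) (φ t)
      linarith
    · rw [show χ s = 0 from indicator_of_notMem (s := {s | s ≤ t - δ}) (not_le.mpr h) _]
      have := hφδ s h hst.2
      linarith
  have h2 : vconv (kappa α lam ε) χ t = (∫ s in (0 : ℝ)..t, kappa α lam ε s) -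
      ∫ s in (0 : ℝ)..δ, kappa α lam ε s := by
    have hi : ∀ u, 0 ≤ u → IntervalIntegrable (kappa α lam ε) volume 0 u := fun u hu => by
      rw [intervalIntegrable_iff_integrableOn_Ioc_of_le hu]
      exact hk.mono_set Ioc_subset_Ioi_self
    rw [intervalIntegral.integral_interval_sub_left (hi t ht.le) (hi δ hδ.le), vconv]
    have e : (fun s => kappa α lam ε (t - s) * χ s) =
        {s | s ≤ t - δ}.indicator fun s => kappa α lam ε (t - s) := by
      funext s
      by_cases h : s ∈ {s | s ≤ t - δ}
      · simp only [χ, indicator_of_mem h, mul_one]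
      · simp only [χ, indicator_of_notMem h, mul_zero]
    rw [e, intervalIntegral.integral_indicator ⟨by linarith, by linarith⟩,
      intervalIntegral.integral_comp_sub_left (fun s => kappa α lam ε s), sub_sub_cancel, sub_zero]
  rw [vconv_sub hk hφ hc ht.le, vconv_const, vconv_add hk
    (EssBddOn.const hη η (abs_of_nonneg hη).le) (hχ.const_mul _) ht.le, vconv_const,
    vconv_const_mul, h2] at h1
  have h3 := mul_integral_kappa_le hα hlam hε ht.le
  have h4 := one_sub_mul_integral_kappa_le hα hlam hε hδ
  have h5 : ∫ s in (0 : ℝ)..δ, kappa α lam ε s ≤ ∫ s in (0 : ℝ)..t, kappa α lam ε s := by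
    refine intervalIntegral.integral_mono_interval le_rfl hδ.le hδt ?_ ?_
    · filter_upwards [ae_restrict_mem measurableSet_Ioc] with s hs using hk0 s hs.1
    · rw [intervalIntegrable_iff_integrableOn_Ioc_of_le ht.le]
      exact hk.mono_set Ioc_subset_Ioi_self
  set I := ∫ s in (0 : ℝ)..t, kappa α lam ε s
  set J := ∫ s in (0 : ℝ)..δ, kappa α lam ε s
  set ρ := ε / (lam * powKer (α + 1) δ)
  have h6 : lam * |vconv (kappa α lam ε) φ t - I * φ t| ≤ η + 2 * B * ρ := by
    have := mul_le_mul_of_nonneg_left h1 hlam.le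
    have h7 : lam * I * η ≤ 1 * η := mul_le_mul_of_nonneg_right h3 hη
    have h8 : 2 * B * (lam * I - lam * J) ≤ 2 * B * ρ :=
      mul_le_mul_of_nonneg_left (by linarith) (by linarith)
    nlinarith
  -- The missing mass on [0, t] contributes the third B.
  have h9 : |(1 - lam * I) * φ t| ≤ ρ * B := by
    rw [abs_mul, abs_of_nonneg (by linarith)]
    have : lam * J ≤ lam * I := mul_le_mul_of_nonneg_left h5 hlam.le
    exact mul_le_mul (by linarith) hφt (abs_nonneg _) (by linarith)
  have e : lam * vconv (kappa α lam ε) φ t - φ t =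
      lam * (vconv (kappa α lam ε) φ t - I * φ t) - (1 - lam * I) * φ t := by ring
  rw [e]
  refine (abs_sub _ _).trans ?_
  rw [abs_mul lam, abs_of_pos hlam]
  linarith

theorem tendsto_mul_vconv_kappa (hα : α ∈ Ioo 0 1) (hlam : 0 < lam) {φ : ℝ → ℝ}
    (hφ : Continuous φ) {t : ℝ} (ht : 0 < t) :
    Tendsto (fun ε => lam * vconv (kappa α lam ε) φ t - φ t) (𝓝[>] 0) (𝓝 0) := by
  rw [Metric.tendsto_nhds]
  intro η hη
  obtain ⟨B, hB⟩ := ContinuousOn.essBddOn (T := t) hφ.continuousOn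
  have hB' : EssBddOn φ t (max B |φ t|) :=
    ⟨hB.meas, le_max_of_le_left hB.nonneg, hB.bound.mono fun s hs => hs.trans (le_max_left _ _)⟩
  obtain ⟨δ, hδ, hδφ⟩ := Metric.continuousAt_iff.mp hφ.continuousAt (η / 2) (half_pos hη)
  -- Half of δ gives the strict inequality that continuity requires; d ≤ t keeps the window inside
  -- [0, t].
  set d := min (δ / 2) t
  have hd : 0 < d := lt_min (half_pos hδ) ht
  have hlim : Tendsto (fun ε => η / 2 + 3 * max B |φ t| * (ε / (lam * powKer (α + 1) d)))
      (𝓝[>] 0) (𝓝 (η / 2)) := by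
    have : Continuous fun ε => η / 2 + 3 * max B |φ t| * (ε / (lam * powKer (α + 1) d)) := by
      fun_prop
    simpa using (this.tendsto 0).mono_left nhdsWithin_le_nhds
  filter_upwards [hlim.eventually (gt_mem_nhds (half_lt_self hη)), self_mem_nhdsWithin]
    with ε h1 hε
  rw [Real.dist_eq, sub_zero]
  refine (abs_mul_vconv_kappa_sub_le hα hlam hε hd (min_le_right _ _) (half_pos hη).le hB'
    (le_max_right _ _) fun s hs hst => ?_).trans_lt h1
  rw [← Real.dist_eq]
  refine (hδφ ?_).le
  rw [Real.dist_eq, abs_sub_comm, abs_of_nonneg (by linarith)]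
  have : d ≤ δ / 2 := min_le_left _ _
  linarith

theorem mul_integral_abs_vconv_kappa_le (hα : α ∈ Ioo 0 1) (hlam : 0 < lam) (hε : 0 < ε)
    {g : ℝ → ℝ} {T B : ℝ} (hg : EssBddOn g T B) :
    lam * ∫ t in Icc 0 T, |vconv (kappa α lam ε) g t| ≤ ∫ t in Icc 0 T, |g t| := by
  have h1 := integral_abs_vconv_le (integrableOn_kappa hα hlam hε)
    (fun s => kappa_nonneg hα hlam hε) hg
  have h2 := mul_integral_Ioi_kappa_le hα hlam hε
  have h3 : 0 ≤ ∫ t in Icc 0 T, |g t| := integral_nonneg fun _ => abs_nonneg _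
  nlinarith [mul_le_mul_of_nonneg_left h1 hlam.le]

/-- The kernels `lam * κ_ε` are an approximate identity in `L¹(0, T)`. -/
theorem tendsto_integral_abs_mul_vconv_kappa_sub (hα : α ∈ Ioo 0 1) (hlam : 0 < lam)
    {g : ℝ → ℝ} {T B : ℝ} (hg : EssBddOn g T B) :
    Tendsto (fun ε => ∫ t in Icc 0 T, |lam * vconv (kappa α lam ε) g t - g t|)
      (𝓝[>] 0) (𝓝 0) := by
  have hcont : ∀ {φ : ℝ → ℝ}, Continuous φ →
      Tendsto (fun ε => ∫ t in Icc 0 T, |lam * vconv (kappa α lam ε) φ t - φ t|)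
        (𝓝[>] 0) (𝓝 0) := by
    intro φ hφ
    obtain ⟨C, hC⟩ := ContinuousOn.essBddOn (T := T) hφ.continuousOn
    have := tendsto_integral_filter_of_dominated_convergence (μ := volume.restrict (Icc 0 T))
      (l := 𝓝[>] 0) (F := fun ε t => |lam * vconv (kappa α lam ε) φ t - φ t|) (f := fun _ => 0)
      (fun _ => C + C) ?_ ?_ (integrable_const _) ?_
    · simpa using this
    · filter_upwards [self_mem_nhdsWithin] with ε hε
      exact (((continuousOn_vconv (integrableOn_kappa hα hlam hε) hC).const_mul lam).sub
        hφ.continuousOn).abs.aestronglyMeasurable measurableSet_Icc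
    · filter_upwards [self_mem_nhdsWithin] with ε hε
      filter_upwards [hC.bound, ae_restrict_mem measurableSet_Icc] with t ht htT
      rw [Real.norm_eq_abs, abs_abs]
      refine (abs_sub _ _).trans (add_le_add ?_ ht)
      rw [abs_mul, abs_of_pos hlam]
      have h1 := abs_vconv_le (integrableOn_kappa hα hlam hε)
        (fun s => kappa_nonneg hα hlam hε) (hC.mono htT.2) htT.1
      have h2 := mul_integral_kappa_le hα hlam hε htT.1
      nlinarith [mul_le_mul_of_nonneg_left h1 hlam.le, hC.nonneg]
    · have h0 : ∀ᵐ t ∂volume.restrict (Icc 0 T), t ≠ 0 :=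
        ae_restrict_of_ae (Measure.ae_ne volume 0)
      filter_upwards [h0, ae_restrict_mem measurableSet_Icc] with t ht htT
      simpa using (tendsto_mul_vconv_kappa hα hlam hφ (htT.1.lt_of_ne' ht)).abs
  rw [Metric.tendsto_nhds]
  intro η hη
  -- Density of continuous functions: g - φ costs η/4 directly and, by Young, at most η/4 through
  -- the convolution, leaving less than η/2 for φ.
  obtain ⟨φ, -, hφg, hφ, hφi⟩ :=
    hg.integrable_indicator.exists_hasCompactSupport_integral_sub_le (ε := η / 4) (by positivity)
  obtain ⟨C, hC⟩ := ContinuousOn.essBddOn (T := T) hφ.continuousOn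
  have hd := hg.sub hC
  have hd1 : ∫ t in Icc 0 T, |g t - φ t| ≤ η / 4 := by
    refine le_trans ?_ hφg
    rw [← setIntegral_congr_fun (f := fun t => ‖(Icc 0 T).indicator g t - φ t‖) measurableSet_Icc]
    · exact setIntegral_le_integral (hg.integrable_indicator.sub hφi).norm
        (Eventually.of_forall fun _ => norm_nonneg _)
    · intro t ht
      simp only [indicator_of_mem ht, Real.norm_eq_abs]
  filter_upwards [(hcont hφ).eventually (gt_mem_nhds (half_pos hη)), self_mem_nhdsWithin]
    with ε h1 hε
  have hk := integrableOn_kappa hα hlam hε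
  rw [Real.dist_eq, sub_zero, abs_of_nonneg (integral_nonneg fun _ => abs_nonneg _)]
  have hi1 : IntegrableOn (fun t => |lam * vconv (kappa α lam ε) φ t - φ t|) (Icc 0 T) :=
    (((continuousOn_vconv hk hC).const_mul lam).sub hφ.continuousOn).abs.integrableOn_Icc
  have hi2 : IntegrableOn (fun t => lam * |vconv (kappa α lam ε) (fun s => g s - φ s) t|)
      (Icc 0 T) := ((continuousOn_vconv hk hd).abs.const_mul lam).integrableOn_Icc
  have hi3 : IntegrableOn (fun t => |g t - φ t|) (Icc 0 T) := hd.abs.integrableOn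
  have hi4 : IntegrableOn (fun t => |lam * vconv (kappa α lam ε) g t - g t|) (Icc 0 T) :=
    (((continuousOn_vconv hk hg).const_mul lam).integrableOn_Icc.sub hg.integrableOn).abs
  have hle : ∫ t in Icc 0 T, |lam * vconv (kappa α lam ε) g t - g t| ≤
      ∫ t in Icc 0 T, (|lam * vconv (kappa α lam ε) φ t - φ t| +
        lam * |vconv (kappa α lam ε) (fun s => g s - φ s) t| + |g t - φ t|) := by
    refine setIntegral_mono_on hi4 ((hi1.add hi2).add hi3) measurableSet_Icc fun t ht => ?_
    have e : lam * vconv (kappa α lam ε) g t - g t =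
        (lam * vconv (kappa α lam ε) φ t - φ t) +
        lam * vconv (kappa α lam ε) (fun s => g s - φ s) t - (g t - φ t) := by
      rw [vconv_sub hk (hg.mono ht.2) (hC.mono ht.2) ht.1]; ring
    rw [e]
    refine (abs_sub _ _).trans (add_le_add_left ?_ _)
    refine (abs_add_le _ _).trans (add_le_add_right ?_ _)
    rw [abs_mul, abs_of_pos hlam]
  have hi12 : IntegrableOn (fun t => |lam * vconv (kappa α lam ε) φ t - φ t| +
      lam * |vconv (kappa α lam ε) (fun s => g s - φ s) t|) (Icc 0 T) := hi1.add hi2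
  rw [integral_add hi12 hi3, integral_add hi1 hi2, integral_const_mul] at hle
  have h2 := mul_integral_abs_vconv_kappa_le hα hlam hε hd
  linarith

end Kernel

/-! ### The nonlinearity, its monotone shift and the algebraic root -/

/-- The nonlinearity `½ σ² p² + V₁(p)`. -/
noncomputable def nonlin (σ : ℝ) (ν : Measure ℝ) (p : ℝ) : ℝ := 1 / 2 * σ ^ 2 * p ^ 2 + V1 ν p

theorem G_eq_add_nonlin (σ : ℝ) (ν : Measure ℝ) (f : ℝ → ℝ) (s w : ℝ) :
    G σ ν f s w = f s + nonlin σ ν w := by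
  rw [G, nonlin, add_assoc]

/-- With d = (q - p)x, the inequality 1 + u ≤ eᵘ at u = -d and u = d puts the difference between d(1
- e^{qx}) and d(1 - e^{px}), and 1 - e^{px} ≤ -px. -/
theorem exp_integrand_sub_bounds {p q x : ℝ} (hpq : p ≤ q) (hq : q ≤ 0) (hx : 0 ≤ x) :
    0 ≤ (Real.exp (p * x) - 1 - p * x) - (Real.exp (q * x) - 1 - q * x) ∧
    (Real.exp (p * x) - 1 - p * x) - (Real.exp (q * x) - 1 - q * x) ≤ (q - p) * -p * x ^ 2 := by
  have hd : 0 ≤ (q - p) * x := mul_nonneg (sub_nonneg.mpr hpq) hx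
  have h1 : Real.exp (p * x) = Real.exp (q * x) * Real.exp (-((q - p) * x)) := by
    rw [← Real.exp_add]; ring_nf
  have h2 : Real.exp (q * x) = Real.exp (p * x) * Real.exp ((q - p) * x) := by
    rw [← Real.exp_add]; ring_nf
  have h3 := Real.add_one_le_exp (-((q - p) * x))
  have h4 := Real.add_one_le_exp ((q - p) * x)
  have h5 : Real.exp (q * x) ≤ 1 := Real.exp_le_one_iff.mpr (mul_nonpos_of_nonpos_of_nonneg hq hx)
  have h6 := Real.add_one_le_exp (p * x)
  have h7 := Real.exp_pos (q * x)
  have h8 := Real.exp_pos (p * x)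
  constructor
  · have := mul_le_mul_of_nonneg_left h3 h7.le
    rw [← h1] at this
    nlinarith [mul_le_mul_of_nonneg_right h5 hd]
  · have := mul_le_mul_of_nonneg_left h4 h8.le
    rw [← h2] at this
    nlinarith [mul_le_mul_of_nonneg_right h6 hd]

section Nonlin

variable {σ M : ℝ} {ν : Measure ℝ}

theorem integrableOn_sq (hν : ∫⁻ x, ENNReal.ofReal (x ^ 2) ∂ν < ∞) :
    IntegrableOn (fun x : ℝ => x ^ 2) (Ici 0) ν := by
  refine Integrable.integrableOn ?_
  rw [← lintegral_ofReal_ne_top_iff_integrable (by fun_prop)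
    (Eventually.of_forall fun x => sq_nonneg x)]
  exact hν.ne

theorem integrableOn_exp_integrand (hν : ∫⁻ x, ENNReal.ofReal (x ^ 2) ∂ν < ∞) {p : ℝ}
    (hp : p ≤ 0) : IntegrableOn (fun x => Real.exp (p * x) - 1 - p * x) (Ici 0) ν := by
  refine Integrable.mono' ((integrableOn_sq hν).const_mul (p ^ 2))
    (by fun_prop : Measurable fun x => Real.exp (p * x) - 1 - p * x).aestronglyMeasurable ?_
  filter_upwards [ae_restrict_mem measurableSet_Ici] with x hx
  obtain ⟨h1, h2⟩ := exp_integrand_sub_bounds hp le_rfl hx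
  simp only [zero_mul, Real.exp_zero, sub_self, sub_zero, zero_sub] at h1 h2
  rw [Real.norm_of_nonneg h1]
  nlinarith

theorem nonlin_zero : nonlin σ ν 0 = 0 := by simp [nonlin, V1]

/-- A Lipschitz constant of the nonlinearity on `[-M, 0]`. -/
noncomputable def lipConst (σ : ℝ) (ν : Measure ℝ) (M : ℝ) : ℝ :=
  M * (σ ^ 2 + ∫ x in Ici (0 : ℝ), x ^ 2 ∂ν)

theorem lipConst_nonneg (hM : 0 ≤ M) : 0 ≤ lipConst σ ν M :=
  mul_nonneg hM (add_nonneg (sq_nonneg σ) (integral_nonneg fun x => sq_nonneg x))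

theorem nonlin_sub_bounds (hν : ∫⁻ x, ENNReal.ofReal (x ^ 2) ∂ν < ∞) {p q : ℝ} (hMp : -M ≤ p)
    (hpq : p ≤ q) (hq : q ≤ 0) : 0 ≤ nonlin σ ν p - nonlin σ ν q ∧
      nonlin σ ν p - nonlin σ ν q ≤ lipConst σ ν M * (q - p) := by
  have hi1 := integrableOn_exp_integrand hν (hpq.trans hq)
  have hi2 := integrableOn_exp_integrand hν hq
  have hV : V1 ν p - V1 ν q = ∫ x in Ici (0 : ℝ),
      ((Real.exp (p * x) - 1 - p * x) - (Real.exp (q * x) - 1 - q * x)) ∂ν :=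
    (integral_sub hi1 hi2).symm
  have hV1 : 0 ≤ V1 ν p - V1 ν q := by
    rw [hV]
    exact setIntegral_nonneg measurableSet_Ici fun x hx =>
      (exp_integrand_sub_bounds hpq hq hx).1
  have hV2 : V1 ν p - V1 ν q ≤ (q - p) * -p * ∫ x in Ici (0 : ℝ), x ^ 2 ∂ν := by
    rw [hV, ← integral_const_mul]
    exact setIntegral_mono_on (hi1.sub hi2) ((integrableOn_sq hν).const_mul _) measurableSet_Ici
      fun x hx => (exp_integrand_sub_bounds hpq hq hx).2
  have hm : 0 ≤ ∫ x in Ici (0 : ℝ), x ^ 2 ∂ν := integral_nonneg fun x => sq_nonneg x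
  have hσ := sq_nonneg σ
  have hqp : 0 ≤ q - p := by linarith
  have hm2 : (q - p) * -p * ∫ x in Ici (0 : ℝ), x ^ 2 ∂ν ≤
      (q - p) * M * ∫ x in Ici (0 : ℝ), x ^ 2 ∂ν :=
    mul_le_mul_of_nonneg_right (mul_le_mul_of_nonneg_left (by linarith) hqp) hm
  have hq1 : 0 ≤ σ ^ 2 * ((q - p) * -(p + q)) :=
    mul_nonneg hσ (mul_nonneg hqp (by linarith))
  have hq2 : σ ^ 2 * ((q - p) * -(p + q)) ≤ σ ^ 2 * ((q - p) * (2 * M)) :=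
    mul_le_mul_of_nonneg_left (mul_le_mul_of_nonneg_left (by linarith) hqp) hσ
  simp only [nonlin, lipConst]
  constructor <;> nlinarith

theorem nonlin_nonneg (hν : ∫⁻ x, ENNReal.ofReal (x ^ 2) ∂ν < ∞) {p : ℝ} (hp : p ≤ 0) :
    0 ≤ nonlin σ ν p := by
  have := (nonlin_sub_bounds (σ := σ) (M := -p) hν (by simp) hp le_rfl).1
  rwa [nonlin_zero, sub_zero] at this

/-- Truncation of the argument to `[-M, 0]`. -/
noncomputable def clamp (M w : ℝ) : ℝ := max (-M) (min w 0)

theorem clamp_of_mem {w : ℝ} (h1 : -M ≤ w) (h2 : w ≤ 0) : clamp M w = w := by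
  rw [clamp, min_eq_left h2, max_eq_right h1]

theorem clamp_mem (hM : 0 ≤ M) (w : ℝ) : -M ≤ clamp M w ∧ clamp M w ≤ 0 :=
  ⟨le_max_left _ _, max_le (by linarith) (min_le_right _ _)⟩

theorem clamp_mono : Monotone (clamp M) := fun _ _ h =>
  max_le_max le_rfl (min_le_min h le_rfl)

theorem clamp_sub_le {v w : ℝ} (h : v ≤ w) : clamp M w - clamp M v ≤ w - v := by
  simp only [clamp]
  grind

/-- The nonlinearity, truncated to `[-M, 0]` and shifted so as to be monotone. -/
noncomputable def shifted (σ : ℝ) (ν : Measure ℝ) (M w : ℝ) : ℝ :=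
  nonlin σ ν (clamp M w) + lipConst σ ν M * clamp M w

theorem shifted_of_mem {w : ℝ} (h1 : -M ≤ w) (h2 : w ≤ 0) :
    shifted σ ν M w = nonlin σ ν w + lipConst σ ν M * w := by
  rw [shifted, clamp_of_mem h1 h2]

theorem shifted_sub_bounds (hν : ∫⁻ x, ENNReal.ofReal (x ^ 2) ∂ν < ∞) (hM : 0 ≤ M) {v w : ℝ}
    (h : v ≤ w) : 0 ≤ shifted σ ν M w - shifted σ ν M v ∧
      shifted σ ν M w - shifted σ ν M v ≤ lipConst σ ν M * (w - v) := by
  obtain ⟨h1, h2⟩ := nonlin_sub_bounds (σ := σ) hν (clamp_mem hM v).1 (clamp_mono h)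
    (clamp_mem hM w).2
  have h3 := mul_le_mul_of_nonneg_left (clamp_sub_le (M := M) h)
    (lipConst_nonneg (σ := σ) (ν := ν) hM)
  simp only [shifted]
  constructor <;> nlinarith

theorem abs_shifted_sub_le (hν : ∫⁻ x, ENNReal.ofReal (x ^ 2) ∂ν < ∞) (hM : 0 ≤ M) (v w : ℝ) :
    |shifted σ ν M v - shifted σ ν M w| ≤ lipConst σ ν M * |v - w| := by
  rcases le_total v w with h | h
  · obtain ⟨h1, h2⟩ := shifted_sub_bounds (σ := σ) hν hM h
    rwa [abs_sub_comm, abs_of_nonneg h1, abs_sub_comm, abs_of_nonneg (sub_nonneg.mpr h)]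
  · obtain ⟨h1, h2⟩ := shifted_sub_bounds (σ := σ) hν hM h
    rwa [abs_of_nonneg h1, abs_of_nonneg (sub_nonneg.mpr h)]

theorem continuous_shifted (hν : ∫⁻ x, ENNReal.ofReal (x ^ 2) ∂ν < ∞) (hM : 0 ≤ M) :
    Continuous (shifted σ ν M) :=
  (LipschitzWith.of_dist_le_mul (K := (lipConst σ ν M).toNNReal) fun v w => by
    rw [Real.coe_toNNReal _ (lipConst_nonneg hM)]
    exact abs_shifted_sub_le hν hM v w).continuous

theorem shifted_nonpos (hν : ∫⁻ x, ENNReal.ofReal (x ^ 2) ∂ν < ∞) (hM : 0 ≤ M) (w : ℝ) :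
    shifted σ ν M w ≤ 0 := by
  have := (nonlin_sub_bounds (σ := σ) hν (clamp_mem hM w).1 (clamp_mem hM w).2 le_rfl).2
  rw [nonlin_zero] at this
  simp only [shifted]
  linarith

theorem le_shifted (hν : ∫⁻ x, ENNReal.ofReal (x ^ 2) ∂ν < ∞) (hM : 0 ≤ M) (w : ℝ) :
    -(lipConst σ ν M * M) ≤ shifted σ ν M w := by
  have h1 := nonlin_nonneg (σ := σ) hν (clamp_mem hM w).2
  have h2 := mul_le_mul_of_nonneg_left (clamp_mem hM w).1 (lipConst_nonneg (σ := σ) (ν := ν) hM)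
  simp only [shifted]
  linarith

/-- Strict monotonicity of `p ↦ -lam p + nonlin p` on `(-∞, 0]`. -/
theorem mul_abs_sub_le_abs_algebraic (hν : ∫⁻ x, ENNReal.ofReal (x ^ 2) ∂ν < ∞) {lam p q : ℝ}
    (hp : p ≤ 0) (hq : q ≤ 0) :
    lam * |p - q| ≤ |(-lam * p + nonlin σ ν p) - (-lam * q + nonlin σ ν q)| := by
  wlog h : p ≤ q generalizing p q
  · rw [abs_sub_comm, abs_sub_comm (-lam * p + _)]
    exact this hq hp (le_of_not_ge h)
  have h1 := (nonlin_sub_bounds (σ := σ) (M := -p) hν (by simp) h hq).1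
  rw [abs_sub_comm, abs_of_nonneg (sub_nonneg.mpr h)]
  exact le_trans (by nlinarith) (le_abs_self _)

/-- Intermediate values on [-y/lam, 0]: at the left end -lam p already equals y and the nonlinearity
is nonnegative. Continuity is read off from `shifted`. -/
theorem exists_algebraic_root (hν : ∫⁻ x, ENNReal.ofReal (x ^ 2) ∂ν < ∞) {lam : ℝ}
    (hlam : 0 < lam) {y : ℝ} (hy : 0 ≤ y) : ∃ p ≤ 0, -lam * p + nonlin σ ν p = y := by
  have hM : 0 ≤ y / lam := by positivity
  have hc : ContinuousOn (fun p => -lam * p + (shifted σ ν (y / lam) p -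
      lipConst σ ν (y / lam) * p)) (Icc (-(y / lam)) 0) := by
    have := continuous_shifted (σ := σ) hν hM
    fun_prop
  have hc' : ContinuousOn (fun p => -lam * p + nonlin σ ν p) (Icc (-(y / lam)) 0) :=
    hc.congr fun p hp => by simp only; rw [shifted_of_mem hp.1 hp.2]; ring
  have h := intermediate_value_Icc' (by linarith) hc'
  have h1 := nonlin_nonneg (σ := σ) hν (p := -(y / lam)) (by linarith)
  have h2 : -lam * -(y / lam) = y := by field_simp
  obtain ⟨p, hp, hpy⟩ := h (show y ∈ _ from
    ⟨by simp only [mul_zero, nonlin_zero, add_zero]; exact hy, by simp only [h2]; linarith⟩)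
  exact ⟨p, hp.2, hpy⟩

/-- The solution map of the algebraic equation is continuous. -/
theorem exists_continuous_algebraic_inverse (hν : ∫⁻ x, ENNReal.ofReal (x ^ 2) ∂ν < ∞) {lam : ℝ}
    (hlam : 0 < lam) : ∃ r : ℝ → ℝ, Continuous r ∧ ∀ y, 0 ≤ y →
      (r y ≤ 0 ∧ -lam * r y + nonlin σ ν (r y) = y) := by
  -- Replacing y by max y 0 makes the root map total; it is then 1/lam-Lipschitz on the whole line.
  choose r hr0 hr using fun y : ℝ =>
    exists_algebraic_root (σ := σ) hν hlam (le_max_right y 0)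
  refine ⟨r, ?_, fun y hy => ⟨hr0 y, by rw [hr, max_eq_left hy]⟩⟩
  refine (LipschitzWith.of_dist_le_mul (K := (1 / lam).toNNReal) fun y z => ?_).continuous
  rw [Real.coe_toNNReal _ (by positivity), Real.dist_eq, Real.dist_eq, one_div, ← div_eq_inv_mul,
    le_div_iff₀ hlam, mul_comm]
  refine (mul_abs_sub_le_abs_algebraic (σ := σ) hν (hr0 y) (hr0 z)).trans ?_
  rw [hr, hr]
  exact abs_max_sub_max_le_abs _ _ _

end Nonlin

/-! ### Change of the kernel parameter -/

theorem EssBddOn.congr {g h : ℝ → ℝ} {T B : ℝ} (hg : EssBddOn g T B)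
    (hgh : ∀ᵐ s ∂volume.restrict (Icc 0 T), g s = h s) : EssBddOn h T B where
  meas := hg.meas.congr hgh
  nonneg := hg.nonneg
  bound := by
    filter_upwards [hg.bound, hgh] with s h1 h2
    rwa [← h2]

theorem essBddOn_of_memLp {f : ℝ → ℝ} {T : ℝ} (hf : MemLp f ∞ (volume.restrict (Icc 0 T))) :
    ∃ B, EssBddOn f T B := by
  refine ⟨(eLpNorm f ∞ (volume.restrict (Icc 0 T))).toReal, hf.1, ENNReal.toReal_nonneg, ?_⟩
  have h := ae_le_eLpNormEssSup (f := f) (μ := volume.restrict (Icc 0 T))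
  rw [← eLpNorm_exponent_top] at h
  filter_upwards [h] with s hs
  rw [← Real.norm_eq_abs, ← toReal_enorm]
  exact ENNReal.toReal_mono hf.2.ne hs

theorem vconv_congr_ae {k g h : ℝ → ℝ} {t : ℝ} (ht : 0 ≤ t)
    (hgh : ∀ᵐ s ∂volume.restrict (Icc 0 t), g s = h s) : vconv k g t = vconv k h t := by
  simp only [vconv, intervalIntegral.integral_of_le ht]
  refine integral_congr_ae ?_
  filter_upwards [ae_restrict_of_ae_restrict_of_subset Ioc_subset_Icc_self hgh] with s hs
  simp only [hs]

/-- Passing from the kernel with parameter `lam` to the one with parameter `mu`. -/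
theorem eq_vconv_kappa_shift {α lam mu ε : ℝ} (hα : α ∈ Ioo 0 1) (hlam : 0 < lam) (hmu : 0 < mu)
    (hε : 0 < ε) {v ψ : ℝ → ℝ} {T B C : ℝ} (hv : EssBddOn v T B) (hψ : EssBddOn ψ T C)
    (h : ∀ t ∈ Icc 0 T, ψ t = vconv (kappa α lam ε) v t) :
    ∀ t ∈ Icc 0 T, ψ t = vconv (kappa α mu ε) (fun s => v s + (mu - lam) * ψ s) t := by
  intro t ht
  have hk := integrableOn_kappa hα hlam hε
  have hl := integrableOn_kappa hα hmu hε
  -- The resolvent identity convolved with v; associativity then turns the inner convolution into ψ.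
  have h1 : (lam - mu) * vconv (vconv (kappa α mu ε) (kappa α lam ε)) v t =
      vconv (kappa α mu ε) v t - vconv (kappa α lam ε) v t := by
    simp only [vconv]
    rw [← intervalIntegral.integral_const_mul, ← intervalIntegral.integral_sub
      (intervalIntegrable_vconv hl (hv.mono ht.2) ht.1)
      (intervalIntegrable_vconv hk (hv.mono ht.2) ht.1)]
    simp only [intervalIntegral.integral_of_le ht.1, integral_Ioc_eq_integral_Ioo]
    refine setIntegral_congr_fun measurableSet_Ioo fun s hs => ?_
    have := sub_mul_vconv_kappa hα mu lam hε (sub_pos.mpr hs.2)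
    simp only [vconv] at this
    rw [← mul_assoc, this, sub_mul]
  have h2 : vconv (kappa α mu ε) (vconv (kappa α lam ε) v) t = vconv (kappa α mu ε) ψ t :=
    vconv_congr ht.1 (fun _ _ => rfl) fun s hs => (h s ⟨hs.1.le, hs.2.le.trans ht.2⟩).symm
  rw [vconv_assoc hl hk hv ht, h2] at h1
  rw [vconv_add hl (hv.mono ht.2) ((hψ.const_mul (mu - lam)).mono ht.2) ht.1, vconv_const_mul,
    h t ht]
  linarith

/-- A continuous non-positive solution of the Riccati-Volterra equation on `[0, T]`. -/
structure SolvesOn (α lam σ : ℝ) (ν : Measure ℝ) (f : ℝ → ℝ) (ε T : ℝ) (ψ : ℝ → ℝ) : Prop where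
  continuousOn : ContinuousOn ψ (Icc 0 T)
  nonpos : ∀ t ∈ Icc 0 T, ψ t ≤ 0
  eq : ∀ t ∈ Icc 0 T, ψ t = vconv (kappa α lam ε) (fun s => G σ ν f s (ψ s)) t

theorem IsVolterraSolution.solvesOn {α lam σ ε : ℝ} {ν : Measure ℝ} {f ψ : ℝ → ℝ}
    (h : IsVolterraSolution α lam σ ν f ε ψ) (T : ℝ) : SolvesOn α lam σ ν f ε T ψ :=
  ⟨h.continuousOn.mono Icc_subset_Ici_self, fun t ht => h.nonpos t ht.1, fun t ht => h.eq t ht.1⟩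

theorem SolvesOn.mono {α lam σ ε T t : ℝ} {ν : Measure ℝ} {f ψ : ℝ → ℝ}
    (h : SolvesOn α lam σ ν f ε T ψ) (ht : t ≤ T) : SolvesOn α lam σ ν f ε t ψ :=
  have hsub : Icc 0 t ⊆ Icc 0 T := Icc_subset_Icc_right ht
  ⟨h.continuousOn.mono hsub, fun s hs => h.nonpos s (hsub hs), fun s hs => h.eq s (hsub hs)⟩

/-! ### Existence and uniqueness for the Volterra equation -/

section Solve

variable {α lam σ ε T M B : ℝ} {ν : Measure ℝ} {f ψ φ : ℝ → ℝ}

theorem essBddOn_shifted_comp (hν : ∫⁻ x, ENNReal.ofReal (x ^ 2) ∂ν < ∞) (hM : 0 ≤ M)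
    (hψ : AEStronglyMeasurable ψ (volume.restrict (Icc 0 T))) :
    EssBddOn (fun s => shifted σ ν M (ψ s)) T (lipConst σ ν M * M) where
  meas := (continuous_shifted hν hM).comp_aestronglyMeasurable hψ
  nonneg := mul_nonneg (lipConst_nonneg hM) hM
  bound := Eventually.of_forall fun _ => abs_le.mpr
    ⟨le_shifted hν hM _, (shifted_nonpos hν hM _).trans (mul_nonneg (lipConst_nonneg hM) hM)⟩

theorem G_add_eq_shifted {s w : ℝ} (h1 : -M ≤ w) (h2 : w ≤ 0) :
    G σ ν f s w + lipConst σ ν M * w = f s + shifted σ ν M w := by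
  rw [G_eq_add_nonlin, shifted_of_mem h1 h2, add_assoc]

theorem exists_essBddOn_G (hν : ∫⁻ x, ENNReal.ofReal (x ^ 2) ∂ν < ∞) (hf : EssBddOn f T B)
    (hM : 0 ≤ M) (hψ : ContinuousOn ψ (Icc 0 T)) (hψM : ∀ t ∈ Icc 0 T, -M ≤ ψ t ∧ ψ t ≤ 0) :
    ∃ C, EssBddOn (fun s => G σ ν f s (ψ s)) T C := by
  obtain ⟨D, hD⟩ := ContinuousOn.essBddOn hψ
  refine ⟨_, ((hf.add (essBddOn_shifted_comp (σ := σ) hν hM hD.meas)).sub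
    (hD.const_mul (lipConst σ ν M))).congr ?_⟩
  filter_upwards [ae_restrict_mem measurableSet_Icc] with s hs
  rw [← G_add_eq_shifted (hψM s hs).1 (hψM s hs).2, add_sub_cancel_right]

theorem SolvesOn.exists_bound (h : SolvesOn α lam σ ν f ε T ψ) :
    ∃ M, 0 ≤ M ∧ ∀ t ∈ Icc 0 T, -M ≤ ψ t ∧ ψ t ≤ 0 := by
  obtain ⟨M, hM⟩ := isCompact_Icc.exists_bound_of_continuousOn h.continuousOn
  refine ⟨max M 0, le_max_right _ _, fun t ht => ⟨?_, h.nonpos t ht⟩⟩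
  have := neg_abs_le (ψ t)
  have := (hM t ht).trans (le_max_left M 0)
  rw [Real.norm_eq_abs] at this
  linarith

/-- On `[0, T]`, the equation is equivalent to one with a monotone Lipschitz nonlinearity. -/
theorem solvesOn_iff_shifted (hα : α ∈ Ioo 0 1) (hlam : 0 < lam) (hε : 0 < ε)
    (hν : ∫⁻ x, ENNReal.ofReal (x ^ 2) ∂ν < ∞) (hf : EssBddOn f T B) (hM : 0 ≤ M)
    (hψ : ContinuousOn ψ (Icc 0 T)) (hψM : ∀ t ∈ Icc 0 T, -M ≤ ψ t ∧ ψ t ≤ 0) :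
    SolvesOn α lam σ ν f ε T ψ ↔ ∀ t ∈ Icc 0 T, ψ t =
      vconv (kappa α (lam + lipConst σ ν M) ε) (fun s => f s + shifted σ ν M (ψ s)) t := by
  obtain ⟨C, hC⟩ := exists_essBddOn_G (σ := σ) hν hf hM hψ hψM
  obtain ⟨D, hD⟩ := ContinuousOn.essBddOn hψ
  have hc := lipConst_nonneg (σ := σ) (ν := ν) hM
  have hmu : 0 < lam + lipConst σ ν M := by linarith
  have hsh : ∀ t ∈ Icc 0 T, vconv (kappa α (lam + lipConst σ ν M) ε)
      (fun s => f s + shifted σ ν M (ψ s)) t = vconv (kappa α (lam + lipConst σ ν M) ε)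
      (fun s => G σ ν f s (ψ s) + lipConst σ ν M * ψ s) t := fun t ht =>
    vconv_congr ht.1 (fun _ _ => rfl) fun s hs =>
      have hs' : s ∈ Icc 0 T := ⟨hs.1.le, hs.2.le.trans ht.2⟩
      (G_add_eq_shifted (hψM s hs').1 (hψM s hs').2).symm
  constructor
  · intro h t ht
    rw [hsh t ht]
    simpa using eq_vconv_kappa_shift hα hlam hmu hε hC hD h.eq t ht
  · intro h
    refine ⟨hψ, fun t ht => (hψM t ht).2, fun t ht => ?_⟩
    have := eq_vconv_kappa_shift hα hmu hlam hε (hC.add (hD.const_mul (lipConst σ ν M))) hD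
      (fun t ht => (h t ht).trans (hsh t ht)) t ht
    rw [this]
    refine vconv_congr ht.1 (fun _ _ => rfl) fun s _ => ?_
    ring

/-- The factor is the Lipschitz constant of `shifted` times the mass bound of the shifted kernel. It
is below 1 because lam > 0. -/
theorem abs_vconv_shifted_sub_le (hα : α ∈ Ioo 0 1) (hlam : 0 < lam) (hε : 0 < ε)
    (hν : ∫⁻ x, ENNReal.ofReal (x ^ 2) ∂ν < ∞) (hf : EssBddOn f T B) (hM : 0 ≤ M)
    (hψ : AEStronglyMeasurable ψ (volume.restrict (Icc 0 T)))
    (hφ : AEStronglyMeasurable φ (volume.restrict (Icc 0 T))) {D : ℝ} (hD : 0 ≤ D)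
    (h : ∀ t ∈ Icc 0 T, |ψ t - φ t| ≤ D) {t : ℝ} (ht : t ∈ Icc 0 T) :
    |vconv (kappa α (lam + lipConst σ ν M) ε) (fun s => f s + shifted σ ν M (ψ s)) t -
      vconv (kappa α (lam + lipConst σ ν M) ε) (fun s => f s + shifted σ ν M (φ s)) t| ≤
      lipConst σ ν M / (lam + lipConst σ ν M) * D := by
  have hc := lipConst_nonneg (σ := σ) (ν := ν) hM
  have hmu : 0 < lam + lipConst σ ν M := by linarith
  have hk := integrableOn_kappa hα hmu hε
  have h1 := (hf.add (essBddOn_shifted_comp (σ := σ) hν hM hψ)).mono ht.2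
  have h2 := (hf.add (essBddOn_shifted_comp (σ := σ) hν hM hφ)).mono ht.2
  rw [← vconv_sub hk h1 h2 ht.1]
  have h3 : EssBddOn (fun s => f s + shifted σ ν M (ψ s) - (f s + shifted σ ν M (φ s))) t
      (lipConst σ ν M * D) := by
    refine ⟨(h1.sub h2).meas, mul_nonneg hc hD, ?_⟩
    filter_upwards [ae_restrict_mem measurableSet_Icc] with s hs
    rw [add_sub_add_left_eq_sub]
    exact (abs_shifted_sub_le hν hM _ _).trans
      (mul_le_mul_of_nonneg_left (h s ⟨hs.1, hs.2.trans ht.2⟩) hc)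
  refine (abs_vconv_le hk (fun s => kappa_nonneg hα hmu hε) h3 ht.1).trans ?_
  have h4 := mul_integral_kappa_le hα hmu hε ht.1
  rw [div_mul_eq_mul_div, le_div_iff₀ hmu]
  nlinarith [mul_nonneg hc hD, mul_le_mul_of_nonneg_right h4 (mul_nonneg hc hD)]

/-- Both solutions lie in a common [-M, 0], where the shifted equation is a contraction; apply this
at a maximum point of |ψ - φ|. -/
theorem SolvesOn.eqOn (hα : α ∈ Ioo 0 1) (hlam : 0 < lam) (hε : 0 < ε)
    (hν : ∫⁻ x, ENNReal.ofReal (x ^ 2) ∂ν < ∞) (hf : EssBddOn f T B) (hT : 0 ≤ T)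
    (hψ : SolvesOn α lam σ ν f ε T ψ) (hφ : SolvesOn α lam σ ν f ε T φ) :
    EqOn ψ φ (Icc 0 T) := by
  obtain ⟨M₁, hM₁, hψM⟩ := hψ.exists_bound
  obtain ⟨M₂, hM₂, hφM⟩ := hφ.exists_bound
  have hM : 0 ≤ max M₁ M₂ := le_max_of_le_left hM₁
  replace hψM : ∀ t ∈ Icc 0 T, -max M₁ M₂ ≤ ψ t ∧ ψ t ≤ 0 := fun t ht =>
    ⟨by linarith [(hψM t ht).1, le_max_left M₁ M₂], (hψM t ht).2⟩
  replace hφM : ∀ t ∈ Icc 0 T, -max M₁ M₂ ≤ φ t ∧ φ t ≤ 0 := fun t ht =>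
    ⟨by linarith [(hφM t ht).1, le_max_right M₁ M₂], (hφM t ht).2⟩
  have h1 := (solvesOn_iff_shifted hα hlam hε hν hf hM hψ.continuousOn hψM).mp hψ
  have h2 := (solvesOn_iff_shifted hα hlam hε hν hf hM hφ.continuousOn hφM).mp hφ
  obtain ⟨t, ht, hmax⟩ := isCompact_Icc.exists_isMaxOn (nonempty_Icc.mpr hT)
    (hψ.continuousOn.sub hφ.continuousOn).abs
  have h3 := abs_vconv_shifted_sub_le (σ := σ) hα hlam hε hν hf hM
    (hψ.continuousOn.aestronglyMeasurable measurableSet_Icc)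
    (hφ.continuousOn.aestronglyMeasurable measurableSet_Icc) (abs_nonneg (ψ t - φ t))
    (fun s hs => hmax hs) ht
  rw [← h1 t ht, ← h2 t ht] at h3
  have hc := lipConst_nonneg (σ := σ) (ν := ν) hM
  have h4 : |ψ t - φ t| ≤ 0 := by
    rw [div_mul_eq_mul_div, le_div_iff₀ (by linarith)] at h3
    nlinarith
  intro s hs
  exact sub_eq_zero.mp (abs_eq_zero.mp (le_antisymm ((hmax hs).trans h4) (abs_nonneg _)))

/-- The a priori lower bound. -/
theorem SolvesOn.neg_div_le (hα : α ∈ Ioo 0 1) (hlam : 0 < lam) (hε : 0 < ε)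
    (hν : ∫⁻ x, ENNReal.ofReal (x ^ 2) ∂ν < ∞) (hf : EssBddOn f T B)
    (hψ : SolvesOn α lam σ ν f ε T ψ) {t : ℝ} (ht : t ∈ Icc 0 T) : -(B / lam) ≤ ψ t := by
  obtain ⟨M, hM, hψM⟩ := hψ.exists_bound
  obtain ⟨C, hC⟩ := exists_essBddOn_G (σ := σ) hν hf hM hψ.continuousOn hψM
  have hB := hf.nonneg
  -- The nonlinearity is nonnegative, so the source is at least -B, and the kernel has mass at most
  -- 1/lam.
  have h1 : vconv (kappa α lam ε) (fun _ => -B) t ≤ ψ t := by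
    rw [hψ.eq t ht]
    refine vconv_mono (integrableOn_kappa hα hlam hε) (fun s => kappa_nonneg hα hlam hε)
      (EssBddOn.const hB (-B) (by rw [abs_neg, abs_of_nonneg hB])) (hC.mono ht.2) ht.1 ?_
    filter_upwards [(hf.mono ht.2).bound, ae_restrict_mem measurableSet_Icc] with s hs hst
    rw [G_eq_add_nonlin]
    have := nonlin_nonneg (σ := σ) hν (hψM s ⟨hst.1, hst.2.trans ht.2⟩).2
    linarith [(abs_le.mp hs).1]
  rw [vconv_const] at h1
  have h2 := mul_integral_kappa_le hα hlam hε ht.1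
  refine le_trans ?_ h1
  rw [neg_le, mul_neg, neg_neg, le_div_iff₀ hlam]
  nlinarith [mul_le_mul_of_nonneg_right h2 hB]

/-- Banach's fixed point theorem for the truncated shifted equation on C([0, T]). The fixed point
lies in [-M, 0], so the truncation is inactive and the equation is the original one. -/
theorem exists_solvesOn (hα : α ∈ Ioo 0 1) (hlam : 0 < lam) (hε : 0 < ε)
    (hν : ∫⁻ x, ENNReal.ofReal (x ^ 2) ∂ν < ∞) (hf : EssBddOn f T B) (hT : 0 ≤ T)
    (hf0 : ∀ t, 0 ≤ t → f t ≤ 0) : ∃ ψ, SolvesOn α lam σ ν f ε T ψ := by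
  have hB := hf.nonneg
  set M := B / lam with hMdef
  have hM : 0 ≤ M := by positivity
  set c := lipConst σ ν M with hcdef
  have hc : 0 ≤ c := lipConst_nonneg hM
  have hmu : 0 < lam + c := by linarith
  have hk := integrableOn_kappa hα hmu hε
  have hk0 : ∀ s, 0 < s → 0 ≤ kappa α (lam + c) ε s := fun s => kappa_nonneg hα hmu hε
  have hext : ∀ ψ : C(Icc (0 : ℝ) T, ℝ), Continuous (IccExtend hT ψ) := fun ψ =>
    ψ.continuous.Icc_extend'
  have hbdd : ∀ ψ : C(Icc (0 : ℝ) T, ℝ), EssBddOn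
      (fun s => f s + shifted σ ν M (IccExtend hT ψ s)) T (B + c * M) := fun ψ =>
    hf.add (essBddOn_shifted_comp hν hM (hext ψ).aestronglyMeasurable)
  let Φ : C(Icc (0 : ℝ) T, ℝ) → C(Icc (0 : ℝ) T, ℝ) := fun ψ =>
    ⟨_, continuousOn_iff_continuous_domRestrict.mp (continuousOn_vconv hk (hbdd ψ))⟩
  have hΦ : ContractingWith (c / (lam + c)).toNNReal Φ := by
    refine ⟨?_, LipschitzWith.of_dist_le_mul fun ψ φ => ?_⟩
    · rw [Real.toNNReal_lt_one, div_lt_one hmu]; linarith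
    · rw [Real.coe_toNNReal _ (by positivity), ContinuousMap.dist_le (by positivity)]
      intro t
      rw [Real.dist_eq]
      refine abs_vconv_shifted_sub_le hα hlam hε hν hf hM (hext ψ).aestronglyMeasurable
        (hext φ).aestronglyMeasurable dist_nonneg (fun s hs => ?_) t.2
      rw [IccExtend_of_mem _ _ hs, IccExtend_of_mem _ _ hs, ← Real.dist_eq]
      exact ContinuousMap.dist_apply_le_dist _
  have hfix : Φ (hΦ.fixedPoint Φ) = hΦ.fixedPoint Φ := hΦ.fixedPoint_isFixedPt
  set ψ := hΦ.fixedPoint Φ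
  have heq : ∀ t ∈ Icc 0 T, IccExtend hT ψ t = vconv (kappa α (lam + c) ε)
      (fun s => f s + shifted σ ν M (IccExtend hT ψ s)) t := fun t ht => by
    conv_lhs => rw [IccExtend_of_mem _ _ ht, ← hfix]
    rfl
  refine ⟨IccExtend hT ψ, (solvesOn_iff_shifted hα hlam hε hν hf hM (hext ψ).continuousOn
    fun t ht => ?_).mpr heq⟩
  have hb := (hbdd ψ).mono ht.2
  rw [heq t ht]
  constructor
  · have hBc : 0 ≤ B + c * M := by positivity
    have h1 : vconv (kappa α (lam + c) ε) (fun _ => -(B + c * M)) t ≤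
        vconv (kappa α (lam + c) ε) (fun s => f s + shifted σ ν M (IccExtend hT ψ s)) t :=
      vconv_mono hk hk0 (EssBddOn.const hBc _ (by rw [abs_neg, abs_of_nonneg hBc])) hb ht.1
        (hb.bound.mono fun s hs => (abs_le.mp hs).1)
    refine le_trans ?_ h1
    rw [vconv_const]
    have h2 := mul_integral_kappa_le hα hmu hε ht.1
    -- This is what M = B/lam is chosen for: the source is at least -(lam + c)M and the mass at most
    -- 1/(lam + c).
    have h3 : B + c * M = (lam + c) * M := by rw [hMdef]; field_simp
    rw [h3]
    nlinarith [mul_le_mul_of_nonneg_right h2 hM]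
  · have h1 : vconv (kappa α (lam + c) ε) (fun s => f s + shifted σ ν M (IccExtend hT ψ s)) t ≤
        vconv (kappa α (lam + c) ε) (fun _ => 0) t := by
      refine vconv_mono hk hk0 hb (EssBddOn.const le_rfl 0 (by simp)) ht.1 ?_
      filter_upwards [ae_restrict_mem measurableSet_Icc] with s hs
      linarith [hf0 s hs.1, shifted_nonpos (σ := σ) hν hM (IccExtend hT ψ s)]
    rwa [vconv_const, mul_zero] at h1

/-- By uniqueness the solutions on [0, n + 1] agree where they overlap and glue together. -/
theorem exists_isVolterraSolution (hα : α ∈ Ioo 0 1) (hlam : 0 < lam) (hε : 0 < ε)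
    (hν : ∫⁻ x, ENNReal.ofReal (x ^ 2) ∂ν < ∞) (hf : ∀ T, 0 < T → ∃ B, EssBddOn f T B)
    (hf0 : ∀ t, 0 ≤ t → f t ≤ 0) : ∃ ψ, IsVolterraSolution α lam σ ν f ε ψ := by
  have hpos : ∀ n : ℕ, (0 : ℝ) < n + 1 := fun n => by positivity
  have hex : ∀ n : ℕ, ∃ ψ, SolvesOn α lam σ ν f ε (n + 1) ψ := fun n => by
    obtain ⟨B, hB⟩ := hf (n + 1) (hpos n)
    exact exists_solvesOn hα hlam hε hν hB (hpos n).le hf0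
  choose Ψ hΨ using hex
  have heq : ∀ n : ℕ, EqOn (fun t => Ψ ⌊t⌋₊ t) (Ψ n) (Icc 0 (n + 1)) := fun n t ht => by
    obtain ⟨B, hB⟩ := hf (n + 1) (hpos n)
    exact ((hΨ ⌊t⌋₊).mono (Nat.lt_floor_add_one t).le).eqOn hα hlam hε hν (hB.mono ht.2) ht.1
      ((hΨ n).mono ht.2) ⟨ht.1, le_rfl⟩
  refine ⟨fun t => Ψ ⌊t⌋₊ t, fun t ht => ?_, fun t ht => ?_, fun t ht => ?_⟩
  · have hmem : t ∈ Icc 0 ((⌊t⌋₊ : ℝ) + 1) := ⟨ht, (Nat.lt_floor_add_one t).le⟩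
    -- As t < ⌊t⌋₊ + 1 strictly, the interval is a neighbourhood of t within [0, ∞).
    refine (((hΨ ⌊t⌋₊).continuousOn.congr (heq ⌊t⌋₊)) t hmem).mono_of_mem_nhdsWithin ?_
    rw [← Ici_inter_Iic]
    exact inter_mem self_mem_nhdsWithin
      (mem_nhdsWithin_of_mem_nhds (Iic_mem_nhds (Nat.lt_floor_add_one t)))
  · exact (hΨ ⌊t⌋₊).nonpos t ⟨ht, (Nat.lt_floor_add_one t).le⟩
  · have hmem : t ∈ Icc 0 ((⌊t⌋₊ : ℝ) + 1) := ⟨ht, (Nat.lt_floor_add_one t).le⟩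
    rw [(hΨ ⌊t⌋₊).eq t hmem]
    exact vconv_congr ht (fun _ _ => rfl) fun s hs =>
      congrArg (G σ ν f s) (heq ⌊t⌋₊ ⟨hs.1.le, hs.2.le.trans hmem.2⟩).symm

/-! ### Algebraic solutions and convergence in L¹ -/

theorem exists_isAlgebraicSolution (hlam : 0 < lam)
    (hν : ∫⁻ x, ENNReal.ofReal (x ^ 2) ∂ν < ∞) (hf0 : ∀ t, 0 ≤ t → f t ≤ 0) :
    ∃ r : ℝ → ℝ, Continuous r ∧ IsAlgebraicSolution lam σ ν f fun t => r (-f t) := by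
  obtain ⟨r, hr, h⟩ := exists_continuous_algebraic_inverse (σ := σ) hν hlam
  refine ⟨r, hr, fun t ht => (h _ (neg_nonneg.mpr (hf0 t ht))).1, fun t ht => ?_⟩
  have := (h _ (neg_nonneg.mpr (hf0 t ht))).2
  rw [nonlin] at this
  linarith

theorem IsAlgebraicSolution.eq_nonlin {ψ₀ : ℝ → ℝ} (h : IsAlgebraicSolution lam σ ν f ψ₀) {t : ℝ}
    (ht : 0 ≤ t) : -lam * ψ₀ t + nonlin σ ν (ψ₀ t) = -f t := by
  have := h.eq t ht
  rw [nonlin]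
  linarith

theorem IsAlgebraicSolution.eqOn (hlam : 0 < lam) (hν : ∫⁻ x, ENNReal.ofReal (x ^ 2) ∂ν < ∞)
    (hψ : IsAlgebraicSolution lam σ ν f ψ) (hφ : IsAlgebraicSolution lam σ ν f φ) :
    EqOn ψ φ (Ici 0) := by
  intro t ht
  have h := mul_abs_sub_le_abs_algebraic (σ := σ) (lam := lam) hν (hψ.nonpos t ht) (hφ.nonpos t ht)
  rw [hψ.eq_nonlin ht, hφ.eq_nonlin ht, sub_self, abs_zero] at h
  have h2 : |ψ t - φ t| ≤ 0 := by
    by_contra hne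
    exact absurd h (not_le.mpr (mul_pos hlam (not_le.mp hne)))
  exact sub_eq_zero.mp (abs_eq_zero.mp (le_antisymm h2 (abs_nonneg _)))

/-- Measurability comes from writing the solution as a continuous function of f; the bound from
dropping the nonnegative nonlinearity. -/
theorem IsAlgebraicSolution.essBddOn (hlam : 0 < lam) (hν : ∫⁻ x, ENNReal.ofReal (x ^ 2) ∂ν < ∞)
    (hf0 : ∀ t, 0 ≤ t → f t ≤ 0) (hf : EssBddOn f T B)
    (hψ : IsAlgebraicSolution lam σ ν f ψ) : EssBddOn ψ T (B / lam) := by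
  obtain ⟨r, hr, hrs⟩ := exists_isAlgebraicSolution (σ := σ) hlam hν hf0
  have hB := hf.nonneg
  refine ⟨(hr.comp_aestronglyMeasurable hf.meas.neg).congr ?_, by positivity, ?_⟩
  · filter_upwards [ae_restrict_mem measurableSet_Icc] with t ht
    exact hrs.eqOn hlam hν hψ ht.1
  · filter_upwards [hf.bound, ae_restrict_mem measurableSet_Icc] with t h ht
    have h1 := hψ.eq_nonlin ht.1
    have h2 := nonlin_nonneg (σ := σ) hν (hψ.nonpos t ht.1)
    rw [abs_of_nonpos (hψ.nonpos t ht.1), le_div_iff₀ hlam]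
    linarith [neg_abs_le (f t)]

/-- Comparison of the Volterra and the algebraic solutions in `L¹(0, T)`. -/
theorem integral_abs_sub_le (hα : α ∈ Ioo 0 1) (hlam : 0 < lam) (hε : 0 < ε)
    (hν : ∫⁻ x, ENNReal.ofReal (x ^ 2) ∂ν < ∞) (hf : EssBddOn f T B)
    (hf0 : ∀ t, 0 ≤ t → f t ≤ 0) (hψ : SolvesOn α lam σ ν f ε T ψ)
    (hφ : IsAlgebraicSolution lam σ ν f φ) {mu : ℝ} (hmu : mu = lam + lipConst σ ν (B / lam)) :
    ∫ t in Icc 0 T, |ψ t - φ t| ≤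
      mu / lam * ∫ t in Icc 0 T, |mu * vconv (kappa α mu ε) φ t - φ t| := by
  have hB := hf.nonneg
  have hM : 0 ≤ B / lam := by positivity
  have hc := lipConst_nonneg (σ := σ) (ν := ν) hM
  have hψM : ∀ t ∈ Icc 0 T, -(B / lam) ≤ ψ t ∧ ψ t ≤ 0 := fun t ht =>
    ⟨hψ.neg_div_le hα hlam hε hν hf ht, hψ.nonpos t ht⟩
  have hφb := hφ.essBddOn hlam hν hf0 hf
  obtain ⟨C, hψb⟩ := ContinuousOn.essBddOn hψ.continuousOn
  have heq := (solvesOn_iff_shifted hα hlam hε hν hf hM hψ.continuousOn hψM).mp hψ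
  rw [← hmu] at heq
  set c := lipConst σ ν (B / lam)
  have hmu0 : 0 < mu := by linarith
  have hk := integrableOn_kappa hα hmu0 hε
  have hψs := essBddOn_shifted_comp (σ := σ) hν hM hψb.meas
  have hφs := essBddOn_shifted_comp (σ := σ) hν hM hφb.meas
  -- The algebraic equation in shifted form, mu φ = f + h(φ), with h the shifted nonlinearity.
  have hfφ : ∀ᵐ s ∂volume.restrict (Icc 0 T), f s + shifted σ ν (B / lam) (ψ s) =
      mu * φ s + (shifted σ ν (B / lam) (ψ s) - shifted σ ν (B / lam) (φ s)) := by
    filter_upwards [hφb.bound, ae_restrict_mem measurableSet_Icc] with s hs hsT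
    have h1 := hφ.eq_nonlin hsT.1
    have h2 := shifted_of_mem (σ := σ) (ν := ν) (abs_le.mp hs).1 (hφ.nonpos s hsT.1)
    rw [hmu, h2]
    linarith
  have hdecomp : ∀ t ∈ Icc 0 T, ψ t - φ t = (mu * vconv (kappa α mu ε) φ t - φ t) +
      vconv (kappa α mu ε)
        (fun s => shifted σ ν (B / lam) (ψ s) - shifted σ ν (B / lam) (φ s)) t := by
    intro t ht
    rw [heq t ht, vconv_congr_ae ht.1
      (ae_restrict_of_ae_restrict_of_subset (Icc_subset_Icc_right ht.2) hfφ),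
      vconv_add hk ((hφb.const_mul mu).mono ht.2) ((hψs.sub hφs).mono ht.2) ht.1,
      vconv_const_mul]
    ring
  have hi1 : IntegrableOn (fun t => |mu * vconv (kappa α mu ε) φ t - φ t|) (Icc 0 T) :=
    (((continuousOn_vconv hk hφb).const_mul mu).integrableOn_Icc.sub hφb.integrableOn).abs
  have hi2 : IntegrableOn (fun t => |vconv (kappa α mu ε)
      (fun s => shifted σ ν (B / lam) (ψ s) - shifted σ ν (B / lam) (φ s)) t|) (Icc 0 T) :=
    (continuousOn_vconv hk (hψs.sub hφs)).abs.integrableOn_Icc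
  have hi3 : IntegrableOn (fun t => |ψ t - φ t|) (Icc 0 T) := (hψb.sub hφb).abs.integrableOn
  have h1 : ∫ t in Icc 0 T, |ψ t - φ t| ≤
      (∫ t in Icc 0 T, |mu * vconv (kappa α mu ε) φ t - φ t|) + ∫ t in Icc 0 T,
        |vconv (kappa α mu ε)
          (fun s => shifted σ ν (B / lam) (ψ s) - shifted σ ν (B / lam) (φ s)) t| := by
    rw [← integral_add hi1 hi2]
    refine setIntegral_mono_on hi3 (hi1.add hi2) measurableSet_Icc fun t ht => ?_
    rw [hdecomp t ht]
    exact abs_add_le _ _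
  have h2 := mul_integral_abs_vconv_kappa_le hα hmu0 hε (hψs.sub hφs)
  have h3 : ∫ t in Icc 0 T, |shifted σ ν (B / lam) (ψ t) - shifted σ ν (B / lam) (φ t)| ≤
      c * ∫ t in Icc 0 T, |ψ t - φ t| := by
    rw [← integral_const_mul]
    exact setIntegral_mono_on (hψs.sub hφs).abs.integrableOn (hi3.const_mul c) measurableSet_Icc
      fun t _ => abs_shifted_sub_le hν hM _ _
  have h4 := mul_le_mul_of_nonneg_left h1 hmu0.le
  -- Absorption: of mu = lam + c on the left, c is used up by the Lipschitz term and lam remains.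
  rw [div_mul_eq_mul_div, le_div_iff₀ hlam]
  rw [mul_add] at h4
  have h5 : mu * ∫ t in Icc 0 T, |ψ t - φ t| = (lam + c) * ∫ t in Icc 0 T, |ψ t - φ t| := by
    rw [hmu]
  linarith [add_mul lam c (∫ t in Icc 0 T, |ψ t - φ t|)]

theorem tendsto_eLpNorm_sub (hα : α ∈ Ioo 0 1) (hlam : 0 < lam)
    (hν : ∫⁻ x, ENNReal.ofReal (x ^ 2) ∂ν < ∞) (hf : EssBddOn f T B)
    (hf0 : ∀ t, 0 ≤ t → f t ≤ 0) {ψ : ℝ → ℝ → ℝ}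
    (hψ : ∀ ε, 0 < ε → SolvesOn α lam σ ν f ε T (ψ ε)) (hφ : IsAlgebraicSolution lam σ ν f φ) :
    Tendsto (fun ε => eLpNorm (fun t => ψ ε t - φ t) 1 (volume.restrict (Ioo 0 T)))
      (𝓝[>] 0) (𝓝 0) := by
  have hφb := hφ.essBddOn hlam hν hf0 hf
  have hc := lipConst_nonneg (σ := σ) (ν := ν) hφb.nonneg
  have hlim := (tendsto_integral_abs_mul_vconv_kappa_sub hα
    (by linarith : 0 < lam + lipConst σ ν (B / lam)) hφb).const_mul
    ((lam + lipConst σ ν (B / lam)) / lam)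
  rw [mul_zero] at hlim
  have hlim' := ENNReal.tendsto_ofReal hlim
  rw [ENNReal.ofReal_zero] at hlim'
  refine tendsto_of_tendsto_of_tendsto_of_le_of_le' tendsto_const_nhds hlim'
    (Eventually.of_forall fun _ => zero_le) ?_
  filter_upwards [self_mem_nhdsWithin] with ε hε
  obtain ⟨C, hC⟩ := ContinuousOn.essBddOn (hψ ε hε).continuousOn
  have hint : IntegrableOn (fun t => ψ ε t - φ t) (Icc 0 T) := (hC.sub hφb).integrableOn
  calc eLpNorm (fun t => ψ ε t - φ t) 1 (volume.restrict (Ioo 0 T))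
      ≤ eLpNorm (fun t => ψ ε t - φ t) 1 (volume.restrict (Icc 0 T)) :=
        eLpNorm_mono_measure _ (Measure.restrict_mono_set _ Ioo_subset_Icc_self)
    _ = ENNReal.ofReal (∫ t in Icc 0 T, |ψ ε t - φ t|) := by
        rw [eLpNorm_one_eq_lintegral_enorm, ← ofReal_integral_norm_eq_lintegral_enorm hint]
        rfl
    _ ≤ _ := ENNReal.ofReal_le_ofReal
        (integral_abs_sub_le hα hlam hε hν hf hf0 (hψ ε hε) hφ rfl)

end Solve

end RoughHeston

theorem lemma2p2
    (α lam σ : ℝ) (hα : α ∈ Ioo (1 / 2 : ℝ) 1) (hlam : 0 < lam)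
    (ν : Measure ℝ) (hν_pos : ν (Iic 0) = 0) (hν_sq : ∫⁻ x, ENNReal.ofReal (x ^ 2) ∂ν < ∞)
    (f : ℝ → ℝ) (hf_nonpos : ∀ t, 0 ≤ t → f t ≤ 0)
    (hf_bdd : ∀ T : ℝ, 0 < T → MemLp f ∞ (volume.restrict (Icc 0 T))) :
    (∀ ε : ℝ, 0 < ε → ∃ ψ : ℝ → ℝ, RoughHeston.IsVolterraSolution α lam σ ν f ε ψ ∧
      ∀ φ : ℝ → ℝ, RoughHeston.IsVolterraSolution α lam σ ν f ε φ → EqOn φ ψ (Ici 0)) ∧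
    (∃ ψ₀ : ℝ → ℝ, RoughHeston.IsAlgebraicSolution lam σ ν f ψ₀ ∧
      ∀ φ : ℝ → ℝ, RoughHeston.IsAlgebraicSolution lam σ ν f φ → EqOn φ ψ₀ (Ici 0)) ∧
    ∀ (ψ : ℝ → ℝ → ℝ) (ψ₀ : ℝ → ℝ),
      (∀ ε : ℝ, 0 < ε → RoughHeston.IsVolterraSolution α lam σ ν f ε (ψ ε)) →
      RoughHeston.IsAlgebraicSolution lam σ ν f ψ₀ →
      ∀ T : ℝ, 0 < T →
        (∀ ε : ℝ, 0 < ε → MemLp (ψ ε) 1 (volume.restrict (Ioo 0 T))) ∧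
        MemLp ψ₀ 1 (volume.restrict (Ioo 0 T)) ∧
        Tendsto (fun ε : ℝ => eLpNorm (fun t => ψ ε t - ψ₀ t) 1 (volume.restrict (Ioo 0 T)))
          (𝓝[>] 0) (𝓝 0) := by
  have hα' : α ∈ Ioo (0 : ℝ) 1 := ⟨by linarith [hα.1], hα.2⟩
  have hf : ∀ T, 0 < T → ∃ B, RoughHeston.EssBddOn f T B := fun T hT =>
    RoughHeston.essBddOn_of_memLp (hf_bdd T hT)
  refine ⟨fun ε hε => ?_, ?_, fun ψ ψ₀ hψ hψ₀ T hT => ?_⟩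
  · obtain ⟨ψ, hψ⟩ :=
      RoughHeston.exists_isVolterraSolution (σ := σ) hα' hlam hε hν_sq hf hf_nonpos
    refine ⟨ψ, hψ, fun φ hφ t ht => ?_⟩
    have ht0 : 0 ≤ t := ht
    -- The horizon t + 1 is positive even when t = 0.
    obtain ⟨B, hB⟩ := hf (t + 1) (by linarith)
    exact (hφ.solvesOn (t + 1)).eqOn hα' hlam hε hν_sq hB (by linarith) (hψ.solvesOn (t + 1))
      ⟨ht, by linarith⟩
  · obtain ⟨r, -, hr⟩ := RoughHeston.exists_isAlgebraicSolution (σ := σ) hlam hν_sq hf_nonpos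
    exact ⟨_, hr, fun φ hφ => hφ.eqOn hlam hν_sq hr⟩
  · obtain ⟨B, hB⟩ := hf T hT
    refine ⟨fun ε hε => ?_, ?_, ?_⟩
    · rw [memLp_one_iff_integrable]
      exact ((hψ ε hε).solvesOn T).continuousOn.integrableOn_Icc.mono_set Ioo_subset_Icc_self
    · rw [memLp_one_iff_integrable]
      exact (hψ₀.essBddOn hlam hν_sq hf_nonpos hB).integrableOn.mono_set Ioo_subset_Icc_self
    · exact RoughHeston.tendsto_eLpNorm_sub hα' hlam hν_sq hB hf_nonpos
        (fun ε hε => (hψ ε hε).solvesOn T) hψ₀
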